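/- **Setting.** An instance of $k$-Median has a finite set $U$ of centers, a set $W$ of $n$ customers, a set $E\subseteq U\times W$ of $m$ edges and costs $c_{ij}\in[0,\infty)$ for $(i,j)\in E$; put $c_{ij}=\infty$ for $(i,j)\notin E$. Assume that $2\le k\le n/3$ and that every customer $j$ has a center $i$ with $c_{ij}=0$. Let $\lambda^*\in[0,\infty]$ be the optimum cost of the linear program that minimizes $\sum_{i,j}c_{ij}y_{ij}$ subject to $x_i\ge y_{ij}\ge 0$ for all $i\in U$, $j\in W$, $\sum_i y_{ij}=1$ for all $j\in W$, and $\sum_i x_i=k$. Let $T=\lceil k\ln(n^2/(2k(2k+1)))\rceil$. For $\lambda\in[0,\infty]$ and $C\subseteq U$ let the capped cost be $$\tilde c(\lambda,C)=\sum_{j\in W}\min\Big(\frac1{2k+1},\ \big(1-\tfrac{2k}{n}\big)\min_{i\in C}c_{ij}/\lambda\Big),\qquad \tfrac00=\tfrac\infty\infty=0,\quad \min\emptyset=\infty .$$ **Algorithm** GREEDY$'$. Start with $\lambda_0=0$, $C_0=\emptyset$, $t=0$. While $\tilde c(\lambda_t,C_t)\ge 1$: increase $t$ by one; let $\tau=(1-\frac1k)\,\tilde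 c(\lambda_{t-1},C_{t-1})+\frac1k(1-\frac{2k}n)$; let $\lambda_t$ be the least $\lambda\in[\lambda_{t-1},\infty]$ with $\min_{i\in U}\tilde c(\lambda,C_{t-1}\cup\{i\})\le\tau$; choose any $i'\in U$ with $\tilde c(\lambda_t,C_{t-1}\cup\{i'\})\le\tau$, and let $C_t=C_{t-1}\cup\{i'\}$. Return the last pair $(\lambda_t,C_t)$. **Theorem.** (i) In every execution of GREEDY$'$ the least value $\lambda_t$ and a center $i'$ exist in every iteration, there are at most $T$ iterations, and for every $t$ that is reached, with $p=1-1/k$, $$\lambda_t\le\lambda^*,\qquad \tilde c(\lambda_t,C_t)\le p^t\,\frac n{2k+1}+(1-p^t)\Big(1-\frac{2k}n\Big),\qquad |C_t|\le t .$$ (ii) There is a single real-RAM program (unit-cost arithmetic and comparison of real numbers and of indices) that, given only $k$ and the instance as a list of its edges with their costs, computes in $O(k\,m\log(n/k)\log m)$ time, with an absolute constant, a pair $(\lambda,C)$ returned by some execution of GREEDY$'$; hence $\lambda\le\lambda^*$, $|C|\le T$ and $\tilde c(\lambda,C)<1$. -/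

import Mathlib

open scoped ENNReal

/-! ## The `k`-Median problem

An instance on centers `Fin u` and customers `Fin n` is its cost matrix
`c : Fin u → Fin n → ℝ≥0∞`: the pair `(i, j)` is an edge iff `c i j` is finite. -/

namespace KMedian

/-- The edge set `E`: the center/customer pairs of finite cost. -/
noncomputable def edges {u n : ℕ} (c : Fin u → Fin n → ℝ≥0∞) : Finset (Fin u × Fin n) := by
  classical exact Finset.univ.filter fun e => c e.1 e.2 ≠ ⊤

/-- `m = |E|`. -/
noncomputable def numEdges {u n : ℕ} (c : Fin u → Fin n → ℝ≥0∞) : ℕ := (edges c).card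

/-- The standing assumptions: `2 ≤ k ≤ n / 3`, and every customer has a center of cost zero. -/
structure Admissible {u n : ℕ} (k : ℕ) (c : Fin u → Fin n → ℝ≥0∞) : Prop where
  two_le : 2 ≤ k
  three_mul_le : 3 * k ≤ n
  zero_center : ∀ j, ∃ i, c i j = 0

/-- Feasible solutions of the standard linear-program relaxation. -/
structure LPFeasible {u n : ℕ} (k : ℕ) (x : Fin u → ℝ) (y : Fin u → Fin n → ℝ) : Prop where
  nonneg : ∀ i j, 0 ≤ y i j
  le : ∀ i j, y i j ≤ x i
  assign : ∀ j, ∑ i, y i j = 1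
  size : ∑ i, x i = k

/-- The optimum cost `λ*` of the linear program, in `[0, ∞]` (here `∞ * 0 = 0`). -/
noncomputable def lpOpt {u n : ℕ} (k : ℕ) (c : Fin u → Fin n → ℝ≥0∞) : ℝ≥0∞ :=
  ⨅ (x : Fin u → ℝ) (y : Fin u → Fin n → ℝ) (_ : LPFeasible k x y),
    ∑ i, ∑ j, c i j * ENNReal.ofReal (y i j)

/-- `T = ⌈k ln (n² / (2k(2k+1)))⌉`. -/
noncomputable def T (k n : ℕ) : ℕ :=
  ⌈(k : ℝ) * Real.log ((n : ℝ) ^ 2 / (2 * k * (2 * k + 1)))⌉₊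

/-- The capped cost of customer `j`. Division in `ℝ≥0∞` has `0 / 0 = ∞ / ∞ = 0`, and the minimum
over an empty `C` is `∞`. The capped value is finite, so `toReal` loses nothing. -/
noncomputable def cappedCostAt {u n : ℕ} (k : ℕ) (c : Fin u → Fin n → ℝ≥0∞)
    (lam : ℝ≥0∞) (C : Finset (Fin u)) (j : Fin n) : ℝ :=
  (min (ENNReal.ofReal (1 / (2 * (k : ℝ) + 1)))
    (ENNReal.ofReal (1 - 2 * (k : ℝ) / n) * (⨅ i ∈ C, c i j) / lam)).toReal

/-- The capped cost of a set `C` of centers. -/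
noncomputable def cappedCost {u n : ℕ} (k : ℕ) (c : Fin u → Fin n → ℝ≥0∞)
    (lam : ℝ≥0∞) (C : Finset (Fin u)) : ℝ :=
  ∑ j, cappedCostAt k c lam C j

/-! ## The algorithm `GREEDY'` -/

/-- The target `τ` of an iteration that starts from `(λ, C)`. -/
noncomputable def target {u n : ℕ} (k : ℕ) (c : Fin u → Fin n → ℝ≥0∞)
    (lam : ℝ≥0∞) (C : Finset (Fin u)) : ℝ :=
  (1 - 1 / (k : ℝ)) * cappedCost k c lam C + 1 / (k : ℝ) * (1 - 2 * (k : ℝ) / n)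

/-- One iteration of the loop, from `(lam, C)` to `(lam', C')`: the guard holds, `lam'` is the least
value `μ ≥ lam` for which the minimum over `i` of the capped cost of `C ∪ {i}` is at most `τ`, and
`C'` is `C ∪ {i}` for some `i` that meets this bound at `lam'`. -/
structure GreedyStep {u n : ℕ} (k : ℕ) (c : Fin u → Fin n → ℝ≥0∞)
    (lam : ℝ≥0∞) (C : Finset (Fin u)) (lam' : ℝ≥0∞) (C' : Finset (Fin u)) : Prop where
  guard : 1 ≤ cappedCost k c lam C
  least : IsLeast {μ : ℝ≥0∞ | lam ≤ μ ∧ ∃ i, cappedCost k c μ (insert i C) ≤ target k c lam C} lam'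
  choice : ∃ i, cappedCost k c lam' (insert i C) ≤ target k c lam C ∧ C' = insert i C

/-- `GreedyRun k c t lam C`: some execution reaches `(λ_t, C_t) = (lam, C)` after `t` iterations. -/
inductive GreedyRun {u n : ℕ} (k : ℕ) (c : Fin u → Fin n → ℝ≥0∞) :
    ℕ → ℝ≥0∞ → Finset (Fin u) → Prop
  | start : GreedyRun k c 0 0 ∅
  | next {t : ℕ} {lam lam' : ℝ≥0∞} {C C' : Finset (Fin u)} :
      GreedyRun k c t lam C → GreedyStep k c lam C lam' C' → GreedyRun k c (t + 1) lam' C'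

/-- Some execution stops and returns `(lam, C)`. -/
def GreedyReturns {u n : ℕ} (k : ℕ) (c : Fin u → Fin n → ℝ≥0∞)
    (lam : ℝ≥0∞) (C : Finset (Fin u)) : Prop :=
  ∃ t, GreedyRun k c t lam C ∧ cappedCost k c lam C < 1

/-! ## The machine model

A unit-cost real RAM, programmed in a structured language. Memory consists of arrays of natural
numbers and arrays of reals; an array is named by a fixed number in the program, and its cells are
addressed by computed natural numbers. Naturals can be added, subtracted (truncated), halved and
compared; reals can be added, subtracted, multiplied, divided and compared; naturals can be
converted to reals, but not conversely. The only constants are natural numbers. Every constant,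
memory access, operation, test and assignment costs one step. -/

/-- Memory: cell `i` of array `a` is `nat a i`, respectively `real a i`. -/
structure Mem where
  nat : ℕ → ℕ → ℕ
  real : ℕ → ℕ → ℝ

/-- Expressions for natural numbers. -/
inductive NExpr
  | const (v : ℕ)
  | read (a : ℕ) (i : NExpr)
  | add (e f : NExpr)
  | sub (e f : NExpr)
  | half (e : NExpr)

namespace NExpr

def eval (s : Mem) : NExpr → ℕ
  | const v => v
  | read a i => s.nat a (i.eval s)
  | add e f => e.eval s + f.eval s
  | sub e f => e.eval s - f.eval s
  | half e => e.eval s / 2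

def steps : NExpr → ℕ
  | const _ => 1
  | read _ i => i.steps + 1
  | add e f => e.steps + f.steps + 1
  | sub e f => e.steps + f.steps + 1
  | half e => e.steps + 1

end NExpr

/-- Expressions for reals. -/
inductive RExpr
  | ofNat (e : NExpr)
  | read (a : ℕ) (i : NExpr)
  | add (e f : RExpr)
  | sub (e f : RExpr)
  | mul (e f : RExpr)
  | div (e f : RExpr)

namespace RExpr

noncomputable def eval (s : Mem) : RExpr → ℝ
  | ofNat e => (e.eval s : ℝ)
  | read a i => s.real a (i.eval s)
  | add e f => e.eval s + f.eval s
  | sub e f => e.eval s - f.eval s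
  | mul e f => e.eval s * f.eval s
  | div e f => e.eval s / f.eval s

def steps : RExpr → ℕ
  | ofNat e => e.steps + 1
  | read _ i => i.steps + 1
  | add e f => e.steps + f.steps + 1
  | sub e f => e.steps + f.steps + 1
  | mul e f => e.steps + f.steps + 1
  | div e f => e.steps + f.steps + 1

end RExpr

/-- Tests. -/
inductive Test
  | natLe (e f : NExpr)
  | realLe (e f : RExpr)
  | neg (b : Test)
  | conj (b d : Test)

namespace Test

def Holds (s : Mem) : Test → Prop
  | natLe e f => e.eval s ≤ f.eval s
  | realLe e f => e.eval s ≤ f.eval s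
  | neg b => ¬ b.Holds s
  | conj b d => b.Holds s ∧ d.Holds s

def steps : Test → ℕ
  | natLe e f => e.steps + f.steps + 1
  | realLe e f => e.steps + f.steps + 1
  | neg b => b.steps + 1
  | conj b d => b.steps + d.steps + 1

end Test

/-- Programs. `setNat a i e` stores the value of `e` in cell `i` of the natural array `a`. -/
inductive Prog
  | skip
  | setNat (a : ℕ) (i e : NExpr)
  | setReal (a : ℕ) (i : NExpr) (e : RExpr)
  | seq (p q : Prog)
  | ite (b : Test) (p q : Prog)
  | while (b : Test) (p : Prog)

/-- Store `v` in cell `i` of the natural array `a`. -/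
def Mem.storeNat (s : Mem) (a i v : ℕ) : Mem :=
  { s with nat := Function.update s.nat a (Function.update (s.nat a) i v) }

/-- Store `v` in cell `i` of the real array `a`. -/
noncomputable def Mem.storeReal (s : Mem) (a i : ℕ) (v : ℝ) : Mem :=
  { s with real := Function.update s.real a (Function.update (s.real a) i v) }

/-- `Exec p s t s'`: program `p`, started in memory `s`, halts after `t` steps in memory `s'`. -/
inductive Exec : Prog → Mem → ℕ → Mem → Prop
  | skip (s : Mem) : Exec .skip s 1 s
  | setNat (s : Mem) (a : ℕ) (i e : NExpr) :
      Exec (.setNat a i e) s (i.steps + e.steps + 1) (s.storeNat a (i.eval s) (e.eval s))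
  | setReal (s : Mem) (a : ℕ) (i : NExpr) (e : RExpr) :
      Exec (.setReal a i e) s (i.steps + e.steps + 1) (s.storeReal a (i.eval s) (e.eval s))
  | seq {p q : Prog} {s s' s'' : Mem} {t t' : ℕ} :
      Exec p s t s' → Exec q s' t' s'' → Exec (.seq p q) s (t + t') s''
  | ite_true {b : Test} {p q : Prog} {s s' : Mem} {t : ℕ} :
      b.Holds s → Exec p s t s' → Exec (.ite b p q) s (b.steps + 1 + t) s'
  | ite_false {b : Test} {p q : Prog} {s s' : Mem} {t : ℕ} :
      ¬ b.Holds s → Exec q s t s' → Exec (.ite b p q) s (b.steps + 1 + t) s'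
  | while_true {b : Test} {p : Prog} {s s' s'' : Mem} {t t' : ℕ} :
      b.Holds s → Exec p s t s' → Exec (.while b p) s' t' s'' →
        Exec (.while b p) s (b.steps + 1 + t + t') s''
  | while_false {b : Test} {p : Prog} {s : Mem} :
      ¬ b.Holds s → Exec (.while b p) s (b.steps + 1) s

/-- The memory that holds the instance, as a list `e` of its edges in arbitrary order.
Natural array 0 holds `k, u, n, m`; natural arrays 1 and 2 hold the center and the customer of each
edge, and real array 0 holds its cost. All other cells are zero. -/
noncomputable def input {u n : ℕ} (k : ℕ) (c : Fin u → Fin n → ℝ≥0∞)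
    (e : Fin (numEdges c) ≃ edges c) : Mem where
  nat a l :=
    match a with
    | 0 =>
      match l with
      | 0 => k
      | 1 => u
      | 2 => n
      | 3 => numEdges c
      | _ => 0
    | 1 => if h : l < numEdges c then ((e ⟨l, h⟩).1.1 : ℕ) else 0
    | 2 => if h : l < numEdges c then ((e ⟨l, h⟩).1.2 : ℕ) else 0
    | _ => 0
  real a l :=
    match a with
    | 0 => if h : l < numEdges c then (c (e ⟨l, h⟩).1.1 (e ⟨l, h⟩).1.2).toReal else 0
    | _ => 0

/-- The memory `s` presents the output `(lam, C)`. Natural array 3 holds in cell 0 a flag that is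
nonzero iff `lam = ∞`, and in cell 1 the length of a list of centers, stored in natural array 4,
whose set of entries is `C`. A finite `lam` is stored in cell 0 of real array 1. -/
structure Output {u : ℕ} (s : Mem) (lam : ℝ≥0∞) (C : Finset (Fin u)) : Prop where
  value : (s.nat 3 0 ≠ 0 ∧ lam = ⊤) ∨
    (s.nat 3 0 = 0 ∧ 0 ≤ s.real 1 0 ∧ lam = ENNReal.ofReal (s.real 1 0))
  centers : C.image Fin.val = (Finset.range (s.nat 3 1)).image (s.nat 4)

end KMedian

namespace KMedian

/-! ## A program logic with time bounds -/

/-! Write `a = 1 - 2k/n`. Part (i) is an averaging argument. For a feasible LP solution of cost `L`,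
weight the choice of center `i` by `x i`. Customer `j` is charged its scaled cost to `i` with weight
`y i j` and keeps its old capped cost with weight `x i - y i j`. The weighted total is at most `(k -
1)` times the old capped cost plus `a`, so some center meets the target at `L`
(`exists_cappedCost_insert_le`). Hence the least admissible value never exceeds `L`. The target is a
contraction towards `a < 1`, which gives the geometric bound; with `1 - 1/k ≤ exp (-1/k)` it limits
the number of iterations (`GreedyRun.le_T`). The least value exists because the capped cost is
continuous at finite parameters and vanishes at `∞`.

For part (ii), substitute `λ = a (2k+1) μ`. Then `2k+1` times the capped cost of a customer at
distance `d` is `min 1 (d/μ)`. If no edge cost lies strictly between `L` and `μ`, the scaled total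
is `A + B/μ`, where `A` counts distances above `L` and `B` adds up the others
(`Split.cappedCost_eq`). So on each interval between consecutive edge costs a center meets a target
exactly from `B/(τ - A)` on, if at all. An iteration finds the first feasible edge cost by
bisection, steps back to the preceding one, and minimizes `B/(τ - A)` over the centers
(`BestAt.greedyStep`). One search takes `O(m)` steps: the sums of `C` are shared by all centers, and
each edge corrects the sums of its own center. The costs are sorted once, so an iteration takes `O(m
log m)`, and there are `O(k log (n/k))` iterations.

Correctness of the program is shown with a small Hoare logic with time bounds (`Halts`). Natural
arrays: 5 number of leaves, 6 tournament tree, 7 and 9 loop counters, 8 tree node, 10 and 11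
bisection range, 12 success flag, 13 best center. Real arrays: 2 sorted costs, 3 distances to `C`, 4
and 5 the sums `A` and `B` per center, 6 and 7 those of `C`, 8 scaled target, 9 best breakpoint, 10
current `μ`, 11 threshold `L`, 12 scaled capped cost, 13 the stand-in for `∞`. -/

@[simp] theorem Mem.storeNat_nat (s : Mem) (a i v b : ℕ) :
    (s.storeNat a i v).nat b = if b = a then Function.update (s.nat a) i v else s.nat b := by
  by_cases h : b = a
  · subst h; simp [Mem.storeNat]
  · simp [Mem.storeNat, h]

@[simp] theorem Mem.storeNat_real (s : Mem) (a i v : ℕ) : (s.storeNat a i v).real = s.real := rfl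

@[simp] theorem Mem.storeReal_nat (s : Mem) (a i : ℕ) (v : ℝ) :
    (s.storeReal a i v).nat = s.nat := rfl

@[simp] theorem Mem.storeReal_real (s : Mem) (a i : ℕ) (v : ℝ) (b : ℕ) :
    (s.storeReal a i v).real b =
      if b = a then Function.update (s.real a) i v else s.real b := by
  by_cases h : b = a
  · subst h; simp [Mem.storeReal]
  · simp [Mem.storeReal, h]

namespace Prog

/-- The natural arrays that a program may write. -/
def natWrites : Prog → List ℕ
  | skip => []
  | setNat a _ _ => [a]
  | setReal _ _ _ => []
  | seq p q => p.natWrites ++ q.natWrites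
  | ite _ p q => p.natWrites ++ q.natWrites
  | .while _ p => p.natWrites

/-- The real arrays that a program may write. -/
def realWrites : Prog → List ℕ
  | skip => []
  | setNat _ _ _ => []
  | setReal a _ _ => [a]
  | seq p q => p.realWrites ++ q.realWrites
  | ite _ p q => p.realWrites ++ q.realWrites
  | .while _ p => p.realWrites

/-- An upper bound for the running time of a program without loops. -/
def cost : Prog → ℕ
  | skip => 1
  | setNat _ i e => i.steps + e.steps + 1
  | setReal _ i e => i.steps + e.steps + 1
  | seq p q => p.cost + q.cost
  | ite b p q => b.steps + 1 + max p.cost q.cost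
  | .while _ _ => 0

/-- The weakest precondition of a program without loops. -/
def wp : Prog → (Mem → Prop) → Mem → Prop
  | skip, Q, s => Q s
  | setNat a i e, Q, s => Q (s.storeNat a (i.eval s) (e.eval s))
  | setReal a i e, Q, s => Q (s.storeReal a (i.eval s) (e.eval s))
  | seq p q, Q, s => p.wp (q.wp Q) s
  | ite b p q, Q, s => (b.Holds s → p.wp Q s) ∧ (¬ b.Holds s → q.wp Q s)
  | .while _ _, _, _ => False

end Prog

/-- `s'` agrees with `s` on the arrays that `p` does not write. -/
structure SameOutside (p : Prog) (s s' : Mem) : Prop where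
  nat : ∀ a, a ∉ p.natWrites → s'.nat a = s.nat a
  real : ∀ a, a ∉ p.realWrites → s'.real a = s.real a

theorem SameOutside.refl (p : Prog) (s : Mem) : SameOutside p s s :=
  ⟨fun _ _ => rfl, fun _ _ => rfl⟩

theorem SameOutside.trans {p q r : Prog} {s s' s'' : Mem} (h : SameOutside p s s')
    (h' : SameOutside q s' s'') (hn : ∀ a, a ∉ r.natWrites → a ∉ p.natWrites ∧ a ∉ q.natWrites)
    (hr : ∀ a, a ∉ r.realWrites → a ∉ p.realWrites ∧ a ∉ q.realWrites) : SameOutside r s s'' :=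
  ⟨fun a ha => (h'.nat a (hn a ha).2).trans (h.nat a (hn a ha).1),
    fun a ha => (h'.real a (hr a ha).2).trans (h.real a (hr a ha).1)⟩

/-- The frame rule. The write sets are computable lists, so in later proofs `decide` shows that an
array is untouched. -/
theorem Exec.sameOutside {p : Prog} {s s' : Mem} {t : ℕ} (h : Exec p s t s') :
    SameOutside p s s' := by
  induction h with
  | skip s => exact .refl _ _
  | setNat s a i e =>
    refine ⟨fun b hb => ?_, fun b _ => rfl⟩
    simp only [Prog.natWrites, List.mem_singleton] at hb
    simp [hb]
  | setReal s a i e =>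
    refine ⟨fun b _ => rfl, fun b hb => ?_⟩
    simp only [Prog.realWrites, List.mem_singleton] at hb
    simp [hb]
  | seq _ _ h1 h2 =>
    exact h1.trans h2 (by simp [Prog.natWrites]) (by simp [Prog.realWrites])
  | ite_true _ _ h1 =>
    exact h1.trans (.refl .skip _) (by simp +contextual [Prog.natWrites])
      (by simp +contextual [Prog.realWrites])
  | ite_false _ _ h1 =>
    exact h1.trans (.refl .skip _) (by simp +contextual [Prog.natWrites])
      (by simp +contextual [Prog.realWrites])
  | while_true _ _ _ h1 h2 =>
    exact h1.trans h2 (by simp [Prog.natWrites]) (by simp [Prog.realWrites])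
  | while_false _ => exact .refl _ _

/-- Started in `s`, the program `p` halts within `B` steps in a memory that satisfies `Q`. -/
def Halts (p : Prog) (s : Mem) (B : ℕ) (Q : Mem → Prop) : Prop :=
  ∃ t s', Exec p s t s' ∧ t ≤ B ∧ Q s'

namespace Halts

variable {p q : Prog} {b : Test} {s : Mem} {B B' : ℕ} {Q R : Mem → Prop}

theorem mono (h : Halts p s B Q) (hB : B ≤ B')
    (hQ : ∀ s', SameOutside p s s' → Q s' → R s') : Halts p s B' R := by
  obtain ⟨t, s', he, ht, hq⟩ := h
  exact ⟨t, s', he, ht.trans hB, hQ s' he.sameOutside hq⟩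

theorem seq (hp : Halts p s B R) (hq : ∀ s', SameOutside p s s' → R s' → Halts q s' B' Q) :
    Halts (.seq p q) s (B + B') Q := by
  obtain ⟨t, s', he, ht, hr⟩ := hp
  obtain ⟨t', s'', he', ht', hq⟩ := hq s' he.sameOutside hr
  exact ⟨_, _, he.seq he', by omega, hq⟩

theorem ite (hp : b.Holds s → Halts p s B Q) (hq : ¬ b.Holds s → Halts q s B Q) :
    Halts (.ite b p q) s (b.steps + 1 + B) Q := by
  by_cases hb : b.Holds s
  · obtain ⟨t, s', he, ht, h⟩ := hp hb
    exact ⟨_, _, .ite_true hb he, by omega, h⟩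
  · obtain ⟨t, s', he, ht, h⟩ := hq hb
    exact ⟨_, _, .ite_false hb he, by omega, h⟩

theorem of_wp : ∀ {p : Prog} {s : Mem} {Q : Mem → Prop}, p.wp Q s → Halts p s p.cost Q
  | .skip, s, _, h => ⟨_, _, .skip s, le_rfl, h⟩
  | .setNat a i e, s, _, h => ⟨_, _, .setNat s a i e, le_rfl, h⟩
  | .setReal a i e, s, _, h => ⟨_, _, .setReal s a i e, le_rfl, h⟩
  | .seq _ _, _, _, h => seq (of_wp h) fun _ _ h' => of_wp h'
  | .ite _ _ _, _, _, h =>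
    ite (fun hb => (of_wp (h.1 hb)).mono (le_max_left _ _) fun _ _ => id)
      fun hb => (of_wp (h.2 hb)).mono (le_max_right _ _) fun _ _ => id

theorem seq_wp (h : p.wp (fun s' => Halts q s' B Q) s) : Halts (.seq p q) s (p.cost + B) Q :=
  seq (of_wp h) fun _ _ => id

theorem seq_wp_le {b : ℕ} (hp : p.cost ≤ b) (h : p.wp (fun s' => Halts q s' B Q) s) :
    Halts (.seq p q) s (b + B) Q :=
  (seq_wp h).mono (by omega) fun _ _ => id

/-- An execution of the body from `I t` yields `I (t + 1)`, which forces `t + 1 ≤ N`; so the body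
runs at most `N` times. The extra summand in `N + 1` pays for the final failing test. -/
theorem loop {N : ℕ} (I : ℕ → Mem → Prop) (h0 : I 0 s) (hN : ∀ t s', I t s' → t ≤ N)
    (hstep : ∀ t s', SameOutside p s s' → I t s' → b.Holds s' → Halts p s' B (I (t + 1))) :
    Halts (.while b p) s ((N + 1) * (b.steps + 1 + B)) fun s' => ∃ t, I t s' ∧ ¬ b.Holds s' := by
  have key : ∀ r t s', t + r = N → SameOutside p s s' → I t s' →
      Halts (.while b p) s' ((r + 1) * (b.steps + 1 + B)) fun s' => ∃ t, I t s' ∧ ¬ b.Holds s' := by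
    intro r
    induction r with
    | zero =>
      intro t s' hr hs hI
      by_cases hb : b.Holds s'
      · obtain ⟨t', s'', _, _, h⟩ := hstep t s' hs hI hb
        have := hN _ _ h
        omega
      · exact ⟨_, _, .while_false hb, by nlinarith, t, hI, hb⟩
    | succ r ih =>
      intro t s' hr hs hI
      by_cases hb : b.Holds s'
      · obtain ⟨t', s'', he, ht, h⟩ := hstep t s' hs hI hb
        obtain ⟨t₂, s₃, he', ht', h'⟩ := ih (t + 1) s'' (by omega)
          (hs.trans he.sameOutside (by simp) (by simp)) h
        exact ⟨_, _, .while_true hb he he', by nlinarith, h'⟩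
      · exact ⟨_, _, .while_false hb, by nlinarith, t, hI, hb⟩
  exact key N 0 s (by omega) (.refl _ _) h0

end Halts

/-- The scalar stored in cell `0` of the natural array `a`. -/
abbrev nvar (a : ℕ) : NExpr := .read a (.const 0)

/-- The scalar stored in cell `0` of the real array `a`. -/
abbrev rvar (a : ℕ) : RExpr := .read a (.const 0)

/-- Run `p` while the scalar `a` goes from `0` to the value of cell `j` of the natural array `0`. -/
def forTo (a j : ℕ) (p : Prog) : Prog :=
  .seq (.setNat a (.const 0) (.const 0))
    (.while (.neg (.natLe (.read 0 (.const j)) (nvar a)))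
      (.seq p (.setNat a (.const 0) (.add (nvar a) (.const 1)))))

/-- The hypothesis `hI` makes the invariant insensitive to the counter. The overhead 16 is 7 steps
for the guard, 6 for the increment, and 3 that absorb the initialization. -/
theorem halts_forTo {a j N B : ℕ} {p : Prog} {s : Mem} (hN : s.nat 0 j = N) (ha0 : a ≠ 0)
    (h0p : 0 ∉ p.natWrites) (hap : a ∉ p.natWrites) (I : ℕ → Mem → Prop)
    (hI : ∀ t s v, I t s → I t (s.storeNat a 0 v)) (h0 : I 0 s)
    (hstep : ∀ t s', t < N → SameOutside (forTo a j p) s s' → s'.nat a 0 = t → I t s' →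
      Halts p s' B (I (t + 1))) :
    Halts (forTo a j p) s ((N + 1) * (B + 16)) (I N) := by
  have hw : Halts (.while (.neg (.natLe (.read 0 (.const j)) (nvar a)))
      (.seq p (.setNat a (.const 0) (.add (nvar a) (.const 1))))) (s.storeNat a 0 0)
      ((N + 1) * (7 + (B + 6))) (I N) := by
    refine (Halts.loop (N := N) (fun t s' => t ≤ N ∧ s'.nat a 0 = t ∧ I t s') ?_
      (fun _ _ h => h.1) ?_).mono le_rfl ?_
    · exact ⟨Nat.zero_le _, by simp, hI _ _ _ h0⟩
    · rintro t s' hs ⟨-, ht, hi⟩ hb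
      have h0' : s'.nat 0 = s.nat 0 := by
        rw [hs.nat 0 (by simp [Prog.natWrites, h0p, ha0.symm])]; simp [ha0.symm]
      have htN : t < N := by
        simpa [Test.Holds, NExpr.eval, h0', hN, ht] using hb
      refine (hstep t s' htN ?_ ht hi).seq fun s'' hs'' hi'' => ?_
      · refine ⟨fun b hb => ?_, fun b hb => ?_⟩
        · simp only [forTo, Prog.natWrites, List.mem_append, List.mem_singleton, not_or] at hb
          rw [hs.nat b (by simp [Prog.natWrites, hb])]; simp [hb]
        · simp only [forTo, Prog.realWrites, List.mem_append, List.not_mem_nil, not_or] at hb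
          rw [hs.real b (by simp [Prog.realWrites, hb])]; rfl
      · refine Halts.of_wp (p := .setNat a (.const 0) (.add (nvar a) (.const 1))) ?_
        have : s''.nat a 0 = t := by rw [hs''.nat a hap, ht]
        simp only [Prog.wp, NExpr.eval, this]
        exact ⟨htN, by simp, hI _ _ _ hi''⟩
    · rintro s' hs ⟨t, ⟨h1, h2, h3⟩, hb⟩
      have h0' : s'.nat 0 = s.nat 0 := by
        rw [hs.nat 0 (by simp [Prog.natWrites, h0p, ha0.symm])]; simp [ha0.symm]
      have : N ≤ t := by simpa [Test.Holds, NExpr.eval, h0', hN, h2] using hb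
      rwa [← h1.antisymm this]
  refine (Halts.seq_wp (p := .setNat a (.const 0) (.const 0)) hw).mono ?_ fun _ _ => id
  simp only [Prog.cost, NExpr.steps]
  nlinarith

end KMedian

namespace KMedian

/-! ## The invariants of `GREEDY'` -/

variable {u n k : ℕ} {c : Fin u → Fin n → ℝ≥0∞}

theorem Admissible.k_pos (h : Admissible k c) : (0 : ℝ) < k := by
  have := h.two_le
  exact_mod_cast (by omega : 0 < k)

theorem Admissible.n_pos (h : Admissible k c) : (0 : ℝ) < n := by
  have := h.two_le
  have := h.three_mul_le
  exact_mod_cast (by omega : 0 < n)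

theorem Admissible.slack_pos (h : Admissible k c) : 0 < 1 - 2 * (k : ℝ) / n := by
  have h3 : (3 : ℝ) * k ≤ n := by exact_mod_cast h.three_mul_le
  have := h.k_pos
  rw [sub_pos, div_lt_one h.n_pos]
  linarith

theorem Admissible.one_div_le_one (h : Admissible k c) : 1 / (k : ℝ) ≤ 1 := by
  rw [div_le_one h.k_pos]
  exact_mod_cast (by have := h.two_le; omega : 1 ≤ k)

theorem Admissible.exists_center (h : Admissible k c) : Nonempty (Fin u) := by
  have h0 : 0 < n := by exact_mod_cast h.n_pos
  obtain ⟨i, -⟩ := h.zero_center ⟨0, h0⟩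
  exact ⟨i⟩

theorem cappedCostAt_ne_top (lam : ℝ≥0∞) (C : Finset (Fin u)) (j : Fin n) :
    min (ENNReal.ofReal (1 / (2 * (k : ℝ) + 1)))
      (ENNReal.ofReal (1 - 2 * (k : ℝ) / n) * (⨅ i ∈ C, c i j) / lam) ≠ ⊤ :=
  ((min_le_left _ _).trans_lt ENNReal.ofReal_lt_top).ne

theorem cappedCostAt_nonneg (lam : ℝ≥0∞) (C : Finset (Fin u)) (j : Fin n) :
    0 ≤ cappedCostAt k c lam C j := ENNReal.toReal_nonneg

theorem cappedCostAt_anti {lam lam' : ℝ≥0∞} {C C' : Finset (Fin u)} (h : lam ≤ lam')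
    (hC : C ⊆ C') (j : Fin n) : cappedCostAt k c lam' C' j ≤ cappedCostAt k c lam C j := by
  refine ENNReal.toReal_mono (cappedCostAt_ne_top _ _ _) (min_le_min le_rfl ?_)
  exact ENNReal.div_le_div (mul_le_mul_right (biInf_mono fun i hi => hC hi) _) h

theorem cappedCost_anti {lam lam' : ℝ≥0∞} {C C' : Finset (Fin u)} (h : lam ≤ lam')
    (hC : C ⊆ C') : cappedCost k c lam' C' ≤ cappedCost k c lam C :=
  Finset.sum_le_sum fun j _ => cappedCostAt_anti h hC j

theorem cappedCost_nonneg (lam : ℝ≥0∞) (C : Finset (Fin u)) : 0 ≤ cappedCost k c lam C :=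
  Finset.sum_nonneg fun _ _ => cappedCostAt_nonneg _ _ _

theorem cappedCost_top (C : Finset (Fin u)) : cappedCost k c ⊤ C = 0 := by
  simp [cappedCost, cappedCostAt]

theorem Admissible.target_nonneg (h : Admissible k c) (lam : ℝ≥0∞) (C : Finset (Fin u)) :
    0 ≤ target k c lam C := by
  have h1 := h.one_div_le_one
  have h2 := h.slack_pos
  have h3 := h.k_pos
  have h4 := cappedCost_nonneg (k := k) (c := c) lam C
  exact add_nonneg (mul_nonneg (by linarith) h4) (by positivity)

/-- Inversion is continuous on `[0, ∞]`, and multiplication by a possibly infinite factor is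
continuous where `1/λ ≠ 0`. At `λ = ∞` this can fail: an unconnected customer drops from the cap to
`∞/∞ = 0`. -/
theorem continuousAt_cappedCost {lam : ℝ≥0∞} (h : lam ≠ ⊤) (C : Finset (Fin u)) :
    ContinuousAt (fun μ => cappedCost k c μ C) lam := by
  refine tendsto_finsetSum _ fun j _ => ?_
  refine (ENNReal.tendsto_toReal (cappedCostAt_ne_top _ _ _)).comp
    (tendsto_const_nhds.min ?_)
  simp only [div_eq_mul_inv]
  exact ENNReal.Tendsto.const_mul (continuous_inv.tendsto lam) (.inl (by simpa using h))

theorem Admissible.exists_greedyStep (h : Admissible k c) {lam : ℝ≥0∞} {C : Finset (Fin u)}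
    (hg : 1 ≤ cappedCost k c lam C) : ∃ lam' C', GreedyStep k c lam C lam' C' := by
  obtain ⟨i₀⟩ := h.exists_center
  set S := {μ : ℝ≥0∞ | lam ≤ μ ∧ ∃ i, cappedCost k c μ (insert i C) ≤ target k c lam C} with hS
  have htop : ⊤ ∈ S := ⟨le_top, i₀, by rw [cappedCost_top]; exact h.target_nonneg _ _⟩
  have hmem : sInf S ∈ S := by
    by_cases hs : sInf S = ⊤
    · rwa [hs]
    · refine ⟨le_sInf fun μ hμ => hμ.1, ?_⟩
      by_contra! hcon
      -- If every center missed the target at the infimum, continuity would make all of them miss it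
      -- on a neighborhood, but members of `S` come arbitrarily close to the infimum.
      have hev : ∀ᶠ μ in nhds (sInf S), ∀ i, target k c lam C < cappedCost k c μ (insert i C) :=
        Filter.eventually_all.2 fun i =>
          (continuousAt_cappedCost hs (insert i C)).eventually_const_lt (hcon i)
      obtain ⟨μ, ⟨-, i, hi⟩, hμ⟩ :=
        (((isGLB_sInf S).frequently_nhds_mem ⟨⊤, htop⟩).and_eventually hev).exists
      exact absurd hi (hμ i).not_ge
  obtain ⟨i, hi⟩ := hmem.2
  exact ⟨sInf S, insert i C, hg, ⟨hmem, fun μ hμ => sInf_le hμ⟩, i, hi, rfl⟩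

/-- Averaging over a feasible solution of the linear program yields a good center. -/
theorem Admissible.exists_cappedCost_insert_le (h : Admissible k c) {x : Fin u → ℝ}
    {y : Fin u → Fin n → ℝ} (hxy : LPFeasible k x y) (C : Finset (Fin u)) {L : ℝ≥0∞}
    (hL : ∑ i, ∑ j, c i j * ENNReal.ofReal (y i j) = L) :
    ∃ i, cappedCost k c L (insert i C) ≤
      (1 - 1 / (k : ℝ)) * cappedCost k c L C + 1 / (k : ℝ) * (1 - 2 * (k : ℝ) / n) := by
  have hk := h.k_pos
  set a := 1 - 2 * (k : ℝ) / n with ha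
  have ha0 : 0 < a := h.slack_pos
  have hn : 0 < n := by exact_mod_cast h.n_pos
  have hx : ∀ i, 0 ≤ x i := fun i => (hxy.nonneg i ⟨0, hn⟩).trans (hxy.le i _)
  set q : Fin u → Fin n → ℝ≥0∞ :=
    fun i j => ENNReal.ofReal a * (c i j * ENNReal.ofReal (y i j)) / L with hq
  -- Only `L / L ≤ 1` is needed, which also covers `L = 0` and `L = ∞`.
  have hqsum : ∑ i, ∑ j, q i j ≤ ENNReal.ofReal a := by
    have : ∑ i, ∑ j, q i j = ENNReal.ofReal a * (L / L) := by
      simp only [hq, div_eq_mul_inv, ← Finset.sum_mul, ← Finset.mul_sum, hL]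
      rw [mul_assoc]
    rw [this]
    exact mul_le_of_le_one_right' ENNReal.div_self_le_one
  have hqtop : ∀ i j, q i j ≠ ⊤ := fun i j =>
    (((Finset.single_le_sum (f := fun j => q i j) (fun _ _ => zero_le) (Finset.mem_univ j)).trans
      (Finset.single_le_sum (f := fun i => ∑ j, q i j) (fun _ _ => zero_le)
        (Finset.mem_univ i))).trans_lt (hqsum.trans_lt ENNReal.ofReal_lt_top)).ne
  have hqreal : ∑ i, ∑ j, (q i j).toReal ≤ a := by
    rw [← ENNReal.toReal_ofReal ha0.le]
    refine le_trans (le_of_eq ?_) (ENNReal.toReal_mono ENNReal.ofReal_ne_top hqsum)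
    rw [ENNReal.toReal_sum fun i _ => ENNReal.sum_ne_top.2 fun j _ => hqtop i j]
    exact Finset.sum_congr rfl fun i _ => (ENNReal.toReal_sum fun j _ => hqtop i j).symm
  have hy : ∀ i j, y i j * cappedCostAt k c L (insert i C) j ≤ (q i j).toReal := by
    intro i j
    rw [← ENNReal.toReal_ofReal (hxy.nonneg i j), cappedCostAt, ← ENNReal.toReal_mul]
    refine ENNReal.toReal_mono (hqtop i j) ?_
    calc _ ≤ ENNReal.ofReal (y i j) * (ENNReal.ofReal a * c i j / L) := by
          gcongr
          refine (min_le_right _ _).trans ?_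
          gcongr
          exact iInf₂_le i (Finset.mem_insert_self i C)
      _ = q i j := by simp only [hq, div_eq_mul_inv]; ring
  -- Split `x i = (x i - y i j) + y i j`. The first part is charged the old capped cost, by
  -- monotonicity in the set; the second is charged `q i j`. Summing `x i - y i j` over `i` gives `k
  -- - 1`.
  have hcol : ∑ i, x i * cappedCost k c L (insert i C) ≤ ((k : ℝ) - 1) * cappedCost k c L C + a := by
    calc ∑ i, x i * cappedCost k c L (insert i C)
        ≤ ∑ i, ∑ j, ((x i - y i j) * cappedCostAt k c L C j + (q i j).toReal) := by
          refine Finset.sum_le_sum fun i _ => ?_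
          rw [cappedCost, Finset.mul_sum]
          refine Finset.sum_le_sum fun j _ => ?_
          have h1 := mul_le_mul_of_nonneg_left
            (cappedCostAt_anti (k := k) (c := c) (le_refl L) (Finset.subset_insert i C) j)
            (sub_nonneg.2 (hxy.le i j))
          nlinarith [hy i j]
      _ = ((k : ℝ) - 1) * cappedCost k c L C + ∑ i, ∑ j, (q i j).toReal := by
          simp only [Finset.sum_add_distrib]
          rw [Finset.sum_comm, cappedCost, Finset.mul_sum]
          congr 1
          refine Finset.sum_congr rfl fun j _ => ?_
          rw [← Finset.sum_mul, Finset.sum_sub_distrib, hxy.size, hxy.assign]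
      _ ≤ _ := by linarith
  by_contra! hcon
  set R := (1 - 1 / (k : ℝ)) * cappedCost k c L C + 1 / (k : ℝ) * a with hR
  have hkR : (k : ℝ) * R = ((k : ℝ) - 1) * cappedCost k c L C + a := by
    rw [hR]; field_simp
  have hpos : ∃ i ∈ Finset.univ, 0 < x i := by
    by_contra! hneg
    have := Finset.sum_nonpos hneg
    rw [hxy.size] at this
    linarith
  obtain ⟨i, -, hi⟩ := hpos
  have : ∑ i, x i * R < ∑ i, x i * cappedCost k c L (insert i C) :=
    Finset.sum_lt_sum (fun i _ => mul_le_mul_of_nonneg_left (hcon i).le (hx i))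
      ⟨i, Finset.mem_univ i, mul_lt_mul_of_pos_left (hcon i) hi⟩
  rw [← Finset.sum_mul, hxy.size] at this
  linarith

/-- The induction is carried out for each feasible solution separately, so the infimum `λ*` need not
be attained. Since `λ_{t-1} ≤ L`, the target formed at `λ_{t-1}` is at least the one the averaging
argument reaches at `L`. -/
theorem GreedyRun.le_lpOpt (h : Admissible k c) {t : ℕ} {lam : ℝ≥0∞} {C : Finset (Fin u)}
    (hr : GreedyRun k c t lam C) : lam ≤ lpOpt k c := by
  refine le_iInf fun x => le_iInf fun y => le_iInf fun hxy => ?_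
  induction hr with
  | start => exact zero_le
  | @next t lam lam' C C' _ hs ih =>
    obtain ⟨i, hi⟩ := h.exists_cappedCost_insert_le hxy C rfl
    refine hs.least.2 ⟨ih, i, hi.trans ?_⟩
    have h1 := h.one_div_le_one
    have := cappedCost_anti (k := k) (c := c) ih (subset_refl C)
    exact add_le_add_left (mul_le_mul_of_nonneg_left this (by linarith)) _

theorem GreedyRun.card_le {t : ℕ} {lam : ℝ≥0∞} {C : Finset (Fin u)}
    (hr : GreedyRun k c t lam C) : C.card ≤ t := by
  induction hr with
  | start => simp
  | next _ hs ih =>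
    obtain ⟨i, -, rfl⟩ := hs.choice
    exact (Finset.card_insert_le _ _).trans (by omega)

theorem cappedCost_zero_empty (h : Admissible k c) :
    cappedCost k c 0 ∅ = (n : ℝ) / (2 * k + 1) := by
  have := h.slack_pos
  have h1 : ENNReal.ofReal (1 - 2 * (k : ℝ) / n) ≠ 0 := by simpa using this
  have h2 : (0 : ℝ) ≤ 1 / (2 * k + 1) := by positivity
  have h3 : ∀ j, cappedCostAt k c 0 ∅ j = 1 / (2 * (k : ℝ) + 1) := fun j => by
    have h4 : ⨅ i ∈ (∅ : Finset (Fin u)), c i j = ⊤ := by simp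
    rw [cappedCostAt, h4, ENNReal.mul_top h1, ENNReal.top_div_of_ne_top ENNReal.zero_ne_top,
      min_eq_left le_top, ENNReal.toReal_ofReal h2]
  simp [cappedCost, h3, div_eq_mul_inv]

theorem GreedyRun.cappedCost_le (h : Admissible k c) {t : ℕ} {lam : ℝ≥0∞} {C : Finset (Fin u)}
    (hr : GreedyRun k c t lam C) : cappedCost k c lam C ≤
      (1 - 1 / (k : ℝ)) ^ t * ((n : ℝ) / (2 * k + 1)) +
        (1 - (1 - 1 / (k : ℝ)) ^ t) * (1 - 2 * (k : ℝ) / n) := by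
  induction hr with
  | start => simp [cappedCost_zero_empty h]
  | next _ hs ih =>
    obtain ⟨i, hi, rfl⟩ := hs.choice
    have h1 := h.one_div_le_one
    refine hi.trans ?_
    have := mul_le_mul_of_nonneg_left ih (sub_nonneg.2 h1)
    rw [target, pow_succ]
    nlinarith

/-- The last guard held after `t` iterations, so `1 ≤ p^t n/(2k+1) + (1 - p^t) a`. Because `p^t a >
0`, this gives `2k/n < p^t n/(2k+1) ≤ exp (-t/k) n/(2k+1)` strictly; hence `t` is below the
logarithmic expression and `t + 1` is at most its ceiling. -/
theorem GreedyRun.le_T (h : Admissible k c) {t : ℕ} {lam : ℝ≥0∞} {C : Finset (Fin u)}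
    (hr : GreedyRun k c t lam C) : t ≤ T k n := by
  cases hr with
  | start => exact Nat.zero_le _
  | @next t lam _ C _ hr hs =>
    have hk := h.k_pos
    have hn := h.n_pos
    have h1 := hs.guard.trans (hr.cappedCost_le h)
    set p := 1 - 1 / (k : ℝ) with hp
    have hp0 : 0 ≤ p := sub_nonneg.2 h.one_div_le_one
    have hpt : 0 ≤ p ^ t := pow_nonneg hp0 t
    have hexp : p ^ t ≤ Real.exp (-(t / k)) := by
      have : p ≤ Real.exp (-(1 / k)) := by
        have := Real.add_one_le_exp (-(1 / (k : ℝ))); linarith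
      refine (pow_le_pow_left₀ hp0 this t).trans (le_of_eq ?_)
      rw [← Real.exp_nat_mul]; congr 1; ring
    have hppos : 0 < p := by
      have h2 : (2 : ℝ) ≤ k := by exact_mod_cast h.two_le
      rw [hp, sub_pos, div_lt_one hk]; linarith
    have hslack := h.slack_pos
    have h2 : 2 * (k : ℝ) / n < Real.exp (-(t / k)) * (n / (2 * k + 1)) := by
      have h3 : 0 < p ^ t := pow_pos hppos t
      have h4 : p ^ t * ((n : ℝ) / (2 * k + 1)) ≤ Real.exp (-(t / k)) * (n / (2 * k + 1)) :=
        mul_le_mul_of_nonneg_right hexp (by positivity)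
      nlinarith [mul_pos h3 hslack]
    rw [T, Nat.succ_le_iff, Nat.lt_ceil]
    have h5 : Real.exp (t / k) < (n : ℝ) ^ 2 / (2 * k * (2 * k + 1)) := by
      rw [Real.exp_neg, div_lt_iff₀ hn] at h2
      have hE := Real.exp_pos ((t : ℝ) / k)
      rw [lt_div_iff₀ (by positivity)]
      calc Real.exp (t / k) * (2 * k * (2 * k + 1))
          = (2 * k) * (Real.exp (t / k) * (2 * k + 1)) := by ring
        _ < ((Real.exp (t / k))⁻¹ * (n / (2 * k + 1)) * n) * (Real.exp (t / k) * (2 * k + 1)) :=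
            mul_lt_mul_of_pos_right h2 (by positivity)
        _ = (n : ℝ) ^ 2 := by field_simp
    have h6 := (Real.lt_log_iff_exp_lt ((Real.exp_pos _).trans h5)).2 h5
    rw [div_lt_iff₀ hk] at h6
    linarith

end KMedian

namespace KMedian

/-! ## The capped cost as a function of a real parameter -/

variable {u n k : ℕ} {c : Fin u → Fin n → ℝ≥0∞}

/-- The real number that represents `x`, where all values from `big` on are identified. -/
noncomputable def trunc (big : ℝ) (x : ℝ≥0∞) : ℝ := (min x (ENNReal.ofReal big)).toReal

theorem trunc_mono (big : ℝ) : Monotone (trunc big) := fun _ _ h =>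
  ENNReal.toReal_mono ((min_le_right _ _).trans_lt ENNReal.ofReal_lt_top).ne
    (min_le_min h le_rfl)

theorem trunc_nonneg (big : ℝ) (x : ℝ≥0∞) : 0 ≤ trunc big x := ENNReal.toReal_nonneg

theorem trunc_top {big : ℝ} (h : 0 ≤ big) : trunc big ⊤ = big := by
  simp [trunc, ENNReal.toReal_ofReal h]

theorem trunc_of_le {big : ℝ} {x : ℝ≥0∞} (h : x ≤ ENNReal.ofReal big) :
    trunc big x = x.toReal := by
  rw [trunc, min_eq_left h]

/-- Truncation loses nothing in comparisons with thresholds below `big`; this is why `big` may stand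
for `∞` in real memory cells. -/
theorem trunc_le_iff {big L : ℝ} {x : ℝ≥0∞} (h0 : 0 ≤ L) (hL : L < big) :
    trunc big x ≤ L ↔ x ≤ ENNReal.ofReal L := by
  have hlt : ENNReal.ofReal L < ENNReal.ofReal big :=
    (ENNReal.ofReal_lt_ofReal_iff (h0.trans_lt hL)).2 hL
  rw [trunc, ← ENNReal.le_ofReal_iff_toReal_le
    ((min_le_right _ _).trans_lt ENNReal.ofReal_lt_top).ne h0, min_le_iff, or_iff_left hlt.not_ge]

/-- Whether the cost `d` exceeds the threshold `L`. -/
noncomputable def excess (L d : ℝ) : ℝ := if d ≤ L then 0 else 1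

/-- The cost `d`, if it is within the threshold `L`. -/
noncomputable def within (L d : ℝ) : ℝ := if d ≤ L then d else 0

/-- The connection cost of customer `j` to the centers `C`. -/
noncomputable def dist (c : Fin u → Fin n → ℝ≥0∞) (big : ℝ) (C : Finset (Fin u)) (j : Fin n) : ℝ :=
  trunc big (⨅ i ∈ C, c i j)

theorem dist_empty {big : ℝ} (h : 0 ≤ big) (j : Fin n) : dist c big ∅ j = big := by
  simp [dist, trunc_top h]

theorem dist_insert (big : ℝ) (C : Finset (Fin u)) (i : Fin u) (j : Fin n) :
    dist c big (insert i C) j = min (dist c big C j) (trunc big (c i j)) := by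
  rw [dist, Finset.iInf_insert, (trunc_mono big).map_min, min_comm]
  rfl

/-- The number of customers whose connection cost exceeds `L`. -/
noncomputable def excessSum (c : Fin u → Fin n → ℝ≥0∞) (big L : ℝ) (C : Finset (Fin u)) : ℝ :=
  ∑ j, excess L (dist c big C j)

/-- The sum of the connection costs that are within `L`. -/
noncomputable def withinSum (c : Fin u → Fin n → ℝ≥0∞) (big L : ℝ) (C : Finset (Fin u)) : ℝ :=
  ∑ j, within L (dist c big C j)

theorem withinSum_nonneg (big L : ℝ) (C : Finset (Fin u)) : 0 ≤ withinSum c big L C :=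
  Finset.sum_nonneg fun j _ => by
    rw [within]; split_ifs
    exacts [trunc_nonneg _ _, le_rfl]

theorem withinSum_zero (big : ℝ) (C : Finset (Fin u)) : withinSum c big 0 C = 0 :=
  Finset.sum_eq_zero fun j _ => by
    rw [within]; split_ifs with h
    exacts [h.antisymm (trunc_nonneg _ _), rfl]

/-- The bound `λ` that corresponds to the breakpoint `μ`. -/
noncomputable def bound (k n : ℕ) (μ : ℝ) : ℝ≥0∞ :=
  ENNReal.ofReal ((1 - 2 * (k : ℝ) / n) * (2 * k + 1) * μ)

theorem Admissible.scale_pos (h : Admissible k c) :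
    0 < (1 - 2 * (k : ℝ) / n) * (2 * k + 1) :=
  mul_pos h.slack_pos (by positivity)

theorem Admissible.bound_mono (h : Admissible k c) : Monotone (bound k n) := fun _ _ hxy =>
  ENNReal.ofReal_le_ofReal (mul_le_mul_of_nonneg_left hxy h.scale_pos.le)

theorem Admissible.exists_bound_eq (h : Admissible k c) {x : ℝ≥0∞} (hx : x ≠ ⊤) :
    ∃ μ, 0 ≤ μ ∧ x = bound k n μ := by
  refine ⟨x.toReal / ((1 - 2 * (k : ℝ) / n) * (2 * k + 1)),
    div_nonneg ENNReal.toReal_nonneg h.scale_pos.le, ?_⟩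
  rw [bound, mul_div_cancel₀ _ h.scale_pos.ne', ENNReal.ofReal_toReal hx]

/-- With `λ = a K μ` the left side is `min 1 (d / μ)`. The hypothesis `hd` excludes values strictly
between `L` and `μ`, so comparing `d` with `L` already tells which term attains the minimum. -/
theorem mul_min_div_eq {a K big L μ : ℝ} {d : ℝ≥0∞} (ha : 0 < a) (hK : 0 < K) (h0 : 0 ≤ L)
    (hLμ : L ≤ μ) (hL : L < big)
    (hd : d ≤ ENNReal.ofReal L ∨ ENNReal.ofReal L < d ∧ ENNReal.ofReal μ ≤ d) :
    K * (min (ENNReal.ofReal (1 / K))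
      (ENNReal.ofReal a * d / ENNReal.ofReal (a * K * μ))).toReal =
      excess L (trunc big d) + within L (trunc big d) / μ := by
  have hμ : 0 ≤ μ := h0.trans hLμ
  have hK1 : 0 ≤ 1 / K := by positivity
  have quot : ∀ x : ℝ, 0 ≤ x → 0 < μ → ENNReal.ofReal a * ENNReal.ofReal x /
      ENNReal.ofReal (a * K * μ) = ENNReal.ofReal (x / (K * μ)) := by
    intro x hx hμ
    rw [← ENNReal.ofReal_mul ha.le, ← ENNReal.ofReal_div_of_pos (by positivity)]
    congr 1
    field_simp
  by_cases hdL : d ≤ ENNReal.ofReal L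
  · have hdtop : d ≠ ⊤ := (hdL.trans_lt ENNReal.ofReal_lt_top).ne
    have htr : trunc big d = d.toReal := trunc_of_le (hdL.trans (ENNReal.ofReal_le_ofReal hL.le))
    have hle : d.toReal ≤ L := ENNReal.toReal_le_of_le_ofReal h0 hdL
    rw [htr, excess, within, if_pos hle, if_pos hle, zero_add]
    -- If `μ = 0` then `L = 0` and `d = 0`; both sides vanish because `0 / 0 = 0` in `ℝ≥0∞` as well
    -- as in `ℝ`.
    obtain hμ0 | hμ0 := hμ.eq_or_lt
    · have : d = 0 := by
        rw [le_antisymm (hLμ.trans hμ0.ge) h0] at hdL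
        simpa using hdL
      simp [this]
    · lift d to NNReal using hdtop
      have := quot d d.2 hμ0
      rw [ENNReal.ofReal_coe_nnreal] at this
      rw [this, ENNReal.coe_toReal, min_eq_right, ENNReal.toReal_ofReal (by positivity)]
      · field_simp
      · refine ENNReal.ofReal_le_ofReal ?_
        rw [div_le_div_iff₀ (by positivity) hK]
        rw [ENNReal.coe_toReal] at hle
        nlinarith
  · have hgt : ¬ trunc big d ≤ L := by rwa [trunc_le_iff h0 hL]
    rw [excess, within, if_neg hgt, if_neg hgt, zero_div, add_zero]
    obtain ⟨h1, h2⟩ := hd.resolve_left hdL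
    rw [min_eq_left, ENNReal.toReal_ofReal hK1]
    · field_simp
    · by_cases hdtop : d = ⊤
      · rw [hdtop, ENNReal.mul_top (by simpa using ha), ENNReal.top_div_of_ne_top (by simp)]
        exact le_top
      · obtain hμ0 | hμ0 := hμ.eq_or_lt
        · rw [← hμ0, mul_zero, ENNReal.ofReal_zero, ENNReal.div_zero]
          · exact le_top
          · exact mul_ne_zero (by simpa using ha) (bot_le.trans_lt h1).ne'
        · lift d to NNReal using hdtop
          have := quot d d.2 hμ0
          rw [ENNReal.ofReal_coe_nnreal] at this
          rw [this]
          refine ENNReal.ofReal_le_ofReal ?_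
          rw [ENNReal.ofReal_le_iff_le_toReal (by simp), ENNReal.coe_toReal] at h2
          rw [div_le_div_iff₀ hK (by positivity)]
          nlinarith

/-! ### Capped cost between consecutive breakpoints -/

/-- No cost lies strictly between `L` and `μ`. -/
def Split (c : Fin u → Fin n → ℝ≥0∞) (L μ : ℝ) : Prop :=
  ∀ i j, c i j ≤ ENNReal.ofReal L ∨ ENNReal.ofReal L < c i j ∧ ENNReal.ofReal μ ≤ c i j

theorem Split.refl (L : ℝ) : Split c L L := fun i j =>
  (le_or_gt (c i j) (ENNReal.ofReal L)).imp_right fun h => ⟨h, h.le⟩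

theorem Split.mono {L μ μ' : ℝ} (h : Split c L μ) (hμ : μ' ≤ μ) : Split c L μ' := fun i j =>
  (h i j).imp_right fun h => ⟨h.1, (ENNReal.ofReal_le_ofReal hμ).trans h.2⟩

theorem Split.iInf {L μ : ℝ} (h : Split c L μ) (C : Finset (Fin u)) (j : Fin n) :
    (⨅ i ∈ C, c i j) ≤ ENNReal.ofReal L ∨
      ENNReal.ofReal L < ⨅ i ∈ C, c i j ∧ ENNReal.ofReal μ ≤ ⨅ i ∈ C, c i j := by
  induction C using Finset.induction with
  | empty => right; simp
  | insert i C _ ih =>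
    rw [Finset.iInf_insert]
    rcases h i j with h | h
    · exact .inl (inf_le_left.trans h)
    · rcases ih with ih | ih
      · exact .inl (inf_le_right.trans ih)
      · exact .inr ⟨lt_inf_iff.2 ⟨h.1, ih.1⟩, le_inf h.2 ih.2⟩

theorem Split.cappedCost_eq (h : Admissible k c) {big L μ : ℝ} (hs : Split c L μ) (h0 : 0 ≤ L)
    (hLμ : L ≤ μ) (hL : L < big) (C : Finset (Fin u)) :
    (2 * (k : ℝ) + 1) * cappedCost k c (bound k n μ) C =
      excessSum c big L C + withinSum c big L C / μ := by
  rw [cappedCost, Finset.mul_sum, excessSum, withinSum, Finset.sum_div, ← Finset.sum_add_distrib]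
  exact Finset.sum_congr rfl fun j _ =>
    mul_min_div_eq h.slack_pos (by positivity) h0 hLμ hL (hs.iInf C j)

/-- `c` has an edge at the center `i`. -/
def HasEdge (c : Fin u → Fin n → ℝ≥0∞) (i : Fin u) : Prop := ∃ j, c i j ≠ ⊤

theorem Admissible.exists_hasEdge (h : Admissible k c) : ∃ i, HasEdge c i := by
  have h0 : 0 < n := by exact_mod_cast h.n_pos
  obtain ⟨i, hi⟩ := h.zero_center ⟨0, h0⟩
  exact ⟨i, ⟨0, h0⟩, by simp [hi]⟩

/-- Some center brings the capped cost at the breakpoint `μ` down to `τ`. -/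
def Feasible (k : ℕ) (c : Fin u → Fin n → ℝ≥0∞) (C : Finset (Fin u)) (τ μ : ℝ) : Prop :=
  ∃ i, HasEdge c i ∧ cappedCost k c (bound k n μ) (insert i C) ≤ τ

theorem Admissible.feasible_mono (h : Admissible k c) {C : Finset (Fin u)} {τ μ μ' : ℝ}
    (hf : Feasible k c C τ μ) (hμ : μ ≤ μ') : Feasible k c C τ μ' := by
  obtain ⟨i, hi, hc⟩ := hf
  exact ⟨i, hi, (cappedCost_anti (h.bound_mono hμ) subset_rfl).trans hc⟩

/-- A center without edges leaves the capped cost unchanged, so any center with an edge does at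
least as well. Hence the program may look only at centers that occur in the edge list, and its time
does not depend on `u`. -/
theorem Admissible.exists_hasEdge_le (h : Admissible k c) {C : Finset (Fin u)} {lam : ℝ≥0∞} {τ : ℝ}
    {i : Fin u} (hi : cappedCost k c lam (insert i C) ≤ τ) :
    ∃ i, HasEdge c i ∧ cappedCost k c lam (insert i C) ≤ τ := by
  by_cases he : HasEdge c i
  · exact ⟨i, he, hi⟩
  · obtain ⟨i', hi'⟩ := h.exists_hasEdge
    refine ⟨i', hi', le_trans ?_ hi⟩
    have hc : cappedCost k c lam (insert i C) = cappedCost k c lam C := by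
      simp only [HasEdge, not_exists, not_not] at he
      simp only [cappedCost, cappedCostAt, Finset.iInf_insert, he, top_inf_eq]
    rw [hc]
    exact cappedCost_anti le_rfl (Finset.subset_insert _ _)

/-! ### The least breakpoint that meets a target -/

/-- A center with the values `A` and `B` can reach the target `τ` at some finite breakpoint,
the least of which is `B / (τ - A)`. -/
def Reaches (τ A B : ℝ) : Prop := A ≤ τ ∧ (A < τ ∨ B ≤ 0)

/-- The delicate cases are degenerate: for `A = τ` the inequality needs `B = 0`, and then `B / (τ -
A) = 0 / 0 = 0` is indeed the least breakpoint; for `μ = 0` the hypothesis gives `B = 0`. -/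
theorem add_div_le_iff {τ A B μ : ℝ} (hB : 0 ≤ B) (hμ : 0 ≤ μ) (h0 : μ = 0 → B = 0) :
    A + B / μ ≤ τ ↔ Reaches τ A B ∧ B / (τ - A) ≤ μ := by
  obtain hμ0 | hμ0 := hμ.eq_or_lt
  · simp [h0 hμ0.symm, ← hμ0, Reaches]
  · constructor
    · intro h
      have hA : A ≤ τ := by have := div_nonneg hB hμ; linarith
      have hB' : B ≤ μ * (τ - A) := by
        have : B / μ ≤ τ - A := by linarith
        rwa [div_le_iff₀ hμ0, mul_comm] at this
      refine ⟨⟨hA, ?_⟩, div_le_of_le_mul₀ (sub_nonneg.2 hA) hμ hB'⟩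
      by_contra! hcon
      have : τ - A = 0 := by linarith [hcon.1]
      rw [this, mul_zero] at hB'
      exact absurd hcon.2 hB'.not_gt
    · rintro ⟨⟨hA, hA'⟩, h⟩
      rcases hA.lt_or_eq with hlt | heq
      · rw [div_le_iff₀ (sub_pos.2 hlt)] at h
        have : B / μ ≤ τ - A := by rw [div_le_iff₀ hμ0, mul_comm]; exact h
        linarith
      · rcases hA' with hlt | hB0
        · exact absurd heq hlt.ne
        · simp [le_antisymm hB0 hB, hA]

theorem Reaches.div_nonneg {τ A B : ℝ} (h : Reaches τ A B) (hB : 0 ≤ B) : 0 ≤ B / (τ - A) :=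
  _root_.div_nonneg hB (sub_nonneg.2 h.1)

/-- `(f, v, z)` is the result of a search for the best center at the threshold `L`: `f` tells
whether some center reaches the target, and then `z` is one that minimizes the breakpoint, `v`. -/
structure BestAt (c : Fin u → Fin n → ℝ≥0∞) (C : Finset (Fin u)) (big τ L : ℝ)
    (f : ℕ) (v : ℝ) (z : ℕ) : Prop where
  center : ∃ i : Fin u, HasEdge c i ∧ (i : ℕ) = z ∧
    (f ≠ 0 → Reaches τ (excessSum c big L (insert i C)) (withinSum c big L (insert i C)) ∧
      v = withinSum c big L (insert i C) / (τ - excessSum c big L (insert i C)))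
  least : ∀ i : Fin u, HasEdge c i →
    Reaches τ (excessSum c big L (insert i C)) (withinSum c big L (insert i C)) →
      f ≠ 0 ∧ v ≤ withinSum c big L (insert i C) / (τ - excessSum c big L (insert i C))

theorem Split.cappedCost_le_iff (h : Admissible k c) {big L μ τ : ℝ} (hs : Split c L μ)
    (h0 : 0 ≤ L) (hLμ : L ≤ μ) (hL : L < big) (C : Finset (Fin u)) :
    cappedCost k c (bound k n μ) C ≤ τ ↔
      Reaches ((2 * k + 1) * τ) (excessSum c big L C) (withinSum c big L C) ∧
        withinSum c big L C / ((2 * k + 1) * τ - excessSum c big L C) ≤ μ := by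
  have hK : (0 : ℝ) < 2 * k + 1 := by positivity
  rw [← mul_le_mul_iff_right₀ hK, hs.cappedCost_eq h h0 hLμ hL,
    add_div_le_iff (withinSum_nonneg _ _ _) (h0.trans hLμ)]
  intro hμ
  rw [le_antisymm (hLμ.trans hμ.le) h0, withinSum_zero]

/-- A single search at `L` decides feasibility for every `μ` up to the next cost above `L`: the sums
do not change there, and `v` is the minimum of the individual least breakpoints. -/
theorem BestAt.feasible_iff (h : Admissible k c) {C : Finset (Fin u)} {big τ L v μ : ℝ} {f z : ℕ}
    (hb : BestAt c C big ((2 * k + 1) * τ) L f v z) (h0 : 0 ≤ L) (hL : L < big)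
    (hs : Split c L μ) (hLμ : L ≤ μ) : Feasible k c C τ μ ↔ f ≠ 0 ∧ v ≤ μ := by
  constructor
  · rintro ⟨i, hi, hc⟩
    rw [hs.cappedCost_le_iff h h0 hLμ hL] at hc
    obtain ⟨h1, h2⟩ := hb.least i hi hc.1
    exact ⟨h1, h2.trans hc.2⟩
  · rintro ⟨hf, hv⟩
    obtain ⟨i, hi, -, hc⟩ := hb.center
    refine ⟨i, hi, (hs.cappedCost_le_iff h h0 hLμ hL _).2 ⟨(hc hf).1, ?_⟩⟩
    rwa [← (hc hf).2]

/-- One iteration of `GREEDY'`, if `L` is the last breakpoint before the least feasible one. -/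
theorem BestAt.greedyStep (h : Admissible k c) {C : Finset (Fin u)} {big L v μ : ℝ} {f z : ℕ}
    (hg : 1 ≤ cappedCost k c (bound k n μ) C)
    (hb : BestAt c C big ((2 * k + 1) * target k c (bound k n μ) C) L f v z)
    (h0 : 0 ≤ L) (hL : L < big)
    (hlow : L = 0 ∨ ¬ Feasible k c C (target k c (bound k n μ) C) L)
    (hhigh : (∃ R, L ≤ R ∧ Feasible k c C (target k c (bound k n μ) C) R ∧ Split c L R) ∨
      ∀ x, Split c L x) :
    ∃ i : Fin u, (i : ℕ) = z ∧
      (f ≠ 0 → 0 ≤ v ∧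
        GreedyStep k c (bound k n μ) C (bound k n (max μ v)) (insert i C)) ∧
      (f = 0 → GreedyStep k c (bound k n μ) C ⊤ (insert i C)) := by
  set τ := target k c (bound k n μ) C with hτ
  obtain ⟨i, hi, hiz, hc⟩ := hb.center
  have hle : ∀ x, 0 ≤ x → Feasible k c C τ x → L ≤ x := by
    intro x hx hfx
    rcases hlow with rfl | hlow
    · exact hx
    · by_contra! hcon
      exact hlow (h.feasible_mono hfx hcon.le)
  refine ⟨i, hiz, fun hf => ?_, fun hf => ?_⟩
  · obtain ⟨hr, hv⟩ := hc hf
    have hv0 : 0 ≤ v := by rw [hv]; exact hr.div_nonneg (withinSum_nonneg _ _ _)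
    -- A value `v < L` would make `L` itself feasible, so `L` would have to be the breakpoint `0`,
    -- while `v ≥ 0`.
    have hLv : L ≤ v := by
      by_contra! hcon
      have hfeas := (hb.feasible_iff h h0 hL (.refl L) le_rfl).2 ⟨hf, hcon.le⟩
      rcases hlow with rfl | hlow
      exacts [hcon.not_ge hv0, hlow hfeas]
    have hsv : Split c L v := by
      rcases hhigh with ⟨R, hLR, hR, hs⟩ | hs
      · exact hs.mono ((hb.feasible_iff h h0 hL hs hLR).1 hR).2
      · exact hs v
    have hcv : cappedCost k c (bound k n v) (insert i C) ≤ τ :=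
      (hsv.cappedCost_le_iff h h0 hLv hL _).2 ⟨hr, hv.ge⟩
    -- The search ignores the requirement `λ_t ≥ λ_{t-1}`. Since the capped cost decreases in the
    -- parameter, taking the maximum with the old `μ` restores it.
    have hcv' : cappedCost k c (bound k n (max μ v)) (insert i C) ≤ τ :=
      (cappedCost_anti (h.bound_mono (le_max_right _ _)) subset_rfl).trans hcv
    refine ⟨hv0, hg, ⟨⟨h.bound_mono (le_max_left _ _), i, hcv'⟩, ?_⟩, i, hcv', rfl⟩
    rintro x ⟨hx, i', hi'⟩
    by_cases hxt : x = ⊤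
    · rw [hxt]; exact le_top
    obtain ⟨y, hy, rfl⟩ := h.exists_bound_eq hxt
    rw [h.bound_mono.map_max, max_le_iff]
    refine ⟨hx, h.bound_mono ?_⟩
    by_contra! hyv
    have hfy : Feasible k c C τ y := h.exists_hasEdge_le hi'
    have := hle y hy hfy
    exact absurd ((hb.feasible_iff h h0 hL (hsv.mono hyv.le) this).1 hfy).2 hyv.not_ge
  -- When no center reaches the target on this piece, there is no feasible breakpoint after `L`, so
  -- the piece extends to every finite parameter and only `∞` remains.
  · have hno : ∀ x, Split c L x → L ≤ x → ¬ Feasible k c C τ x := fun x hs hx hfe =>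
      ((hb.feasible_iff h h0 hL hs hx).1 hfe).1 hf
    have hsp : ∀ x, Split c L x := by
      rcases hhigh with ⟨R, hLR, hR, hs⟩ | hs
      · exact absurd hR (hno R hs hLR)
      · exact hs
    have htop : cappedCost k c ⊤ (insert i C) ≤ τ := by
      rw [cappedCost_top]; exact h.target_nonneg _ _
    refine ⟨hg, ⟨⟨le_top, i, htop⟩, ?_⟩, i, htop, rfl⟩
    rintro x ⟨hx, i', hi'⟩
    by_contra! hxt
    obtain ⟨y, hy, rfl⟩ := h.exists_bound_eq hxt.ne
    have hfy : Feasible k c C τ y := h.exists_hasEdge_le hi'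
    exact hno y (hsp y) (hle y hy hfy) hfy

end KMedian

namespace KMedian

/-! ## Sorting by a tournament -/

/-- The winner of a match of two players `x` and `y`; `0` is absent, and the player `l + 1` has
the cost `w l`. -/
noncomputable def winner (w : ℕ → ℝ) (x y : ℕ) : ℕ :=
  open Classical in if y = 0 ∨ x ≠ 0 ∧ w (x - 1) ≤ w (y - 1) then x else y

/-- `T` holds at the nodes below `M` the winners of the matches of their children. -/
def Tournament (w : ℕ → ℝ) (M : ℕ) (T : ℕ → ℕ) : Prop :=
  ∀ v, 1 ≤ v → v < M → T v = winner w (T (v + v)) (T (v + v + 1))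

theorem winner_eq_or (w : ℕ → ℝ) (x y : ℕ) : winner w x y = x ∨ winner w x y = y := by
  rw [winner]; split_ifs <;> simp

theorem winner_left {w : ℕ → ℝ} {x y : ℕ} (hx : x ≠ 0) :
    winner w x y ≠ 0 ∧ w (winner w x y - 1) ≤ w (x - 1) := by
  rw [winner]; split_ifs with h
  · exact ⟨hx, le_rfl⟩
  · push Not at h
    exact ⟨h.1, (h.2 hx).le⟩

theorem winner_right {w : ℕ → ℝ} {x y : ℕ} (hy : y ≠ 0) :
    winner w x y ≠ 0 ∧ w (winner w x y - 1) ≤ w (y - 1) := by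
  rw [winner]; split_ifs with h
  · exact h.resolve_left hy
  · exact ⟨hy, le_rfl⟩

/-- Each winner is copied from a child. The recursion descends to larger indices, hence the
induction on `2 * M - v`. -/
theorem Tournament.exists_leaf {w : ℕ → ℝ} {M : ℕ} {T : ℕ → ℕ} (h : Tournament w M T) :
    ∀ v, 1 ≤ v → v < 2 * M → ∃ l < M, T (M + l) = T v := by
  have key : ∀ r v, v + r = 2 * M → 1 ≤ v → v < 2 * M → ∃ l < M, T (M + l) = T v := by
    intro r
    induction r using Nat.strong_induction_on with
    | _ r ih =>
      intro v hr hv hvM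
      by_cases hlt : v < M
      · rcases winner_eq_or w (T (v + v)) (T (v + v + 1)) with he | he
        · obtain ⟨l, hl, e⟩ := ih (r - v) (by omega) (v + v) (by omega) (by omega) (by omega)
          exact ⟨l, hl, by rw [e, h v hv hlt, he]⟩
        · obtain ⟨l, hl, e⟩ := ih (r - v - 1) (by omega) (v + v + 1) (by omega) (by omega) (by omega)
          exact ⟨l, hl, by rw [e, h v hv hlt, he]⟩
      · exact ⟨v - M, by omega, by congr 1; omega⟩
  intro v hv hvM
  exact key (2 * M - v) v (by omega) hv hvM

/-- Follow the ancestors `p / 2 ^ d` of the leaf: the cost of the stored winner does not increase on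
the way up. -/
theorem Tournament.root_le {w : ℕ → ℝ} {D : ℕ} {T : ℕ → ℕ} (h : Tournament w (2 ^ D) T) {l : ℕ}
    (hl : l < 2 ^ D) (hT : T (2 ^ D + l) ≠ 0) :
    T 1 ≠ 0 ∧ w (T 1 - 1) ≤ w (T (2 ^ D + l) - 1) := by
  set p := 2 ^ D + l with hp
  have key : ∀ d ≤ D, T (p / 2 ^ d) ≠ 0 ∧ w (T (p / 2 ^ d) - 1) ≤ w (T p - 1) := by
    intro d
    induction d with
    | zero => intro _; simpa using hT
    | succ d ih =>
      intro hd
      obtain ⟨h1, h2⟩ := ih (by omega)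
      set v := p / 2 ^ (d + 1) with hv
      have hvd : v = p / 2 ^ d / 2 := by rw [hv, pow_succ, Nat.div_div_eq_div_mul]
      have hv1 : 1 ≤ v := by
        rw [hv, Nat.one_le_div_iff (by positivity)]
        exact (Nat.pow_le_pow_right (by norm_num) hd).trans (by omega)
      have hvM : v < 2 ^ D := by
        have : p / 2 ^ d ≤ p := Nat.div_le_self _ _
        omega
      rw [h v hv1 hvM]
      rcases (by omega : p / 2 ^ d = v + v ∨ p / 2 ^ d = v + v + 1) with e | e <;> rw [e] at h1 h2
      · exact (winner_left h1).imp_right fun h => h.trans h2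
      · exact (winner_right h1).imp_right fun h => h.trans h2
  have h1 : p / 2 ^ D = 1 := by
    rw [hp, Nat.add_div_left _ (by positivity), Nat.div_eq_of_lt hl]
  simpa [h1] using key D le_rfl

/-- Replay the matches on the path from the node in the natural scalar `8` to the root of the
tree in the natural array `6`. -/
def replay : Prog :=
  .while (.natLe (.const 1) (nvar 8))
    (.seq
      (.ite (.neg (.conj (.neg (.natLe (.read 6 (.add (.add (nvar 8) (nvar 8)) (.const 1)))
              (.const 0)))
            (.neg (.conj (.neg (.natLe (.read 6 (.add (nvar 8) (nvar 8))) (.const 0)))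
              (.realLe (.read 0 (.sub (.read 6 (.add (nvar 8) (nvar 8))) (.const 1)))
                (.read 0 (.sub (.read 6 (.add (.add (nvar 8) (nvar 8)) (.const 1)))
                  (.const 1))))))))
        (.setNat 6 (nvar 8) (.read 6 (.add (nvar 8) (nvar 8))))
        (.setNat 6 (nvar 8) (.read 6 (.add (.add (nvar 8) (nvar 8)) (.const 1)))))
      (.setNat 8 (.const 0) (.half (nvar 8))))

/-- After a leaf has changed, only its ancestors can violate the tournament condition. The walk
repairs them from the bottom up, and its invariant is that all violations lie on the rest of the
path. -/
theorem halts_replay {s : Mem} {D : ℕ} (hv : s.nat 8 0 < 2 ^ D)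
    (h : ∀ v, 1 ≤ v → v < 2 ^ D → (∀ d, s.nat 8 0 / 2 ^ d ≠ v) →
      s.nat 6 v = winner (s.real 0) (s.nat 6 (v + v)) (s.nat 6 (v + v + 1))) :
    Halts replay s ((D + 1) * 80) fun s' =>
      Tournament (s.real 0) (2 ^ D) (s'.nat 6) ∧ ∀ p, 2 ^ D ≤ p → s'.nat 6 p = s.nat 6 p := by
  refine (Halts.loop (N := D) (B := 74) (fun t s' => t ≤ D ∧ s'.nat 8 0 < 2 ^ (D - t) ∧
    (∀ v, 1 ≤ v → v < 2 ^ D → (∀ d, s'.nat 8 0 / 2 ^ d ≠ v) →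
      s'.nat 6 v = winner (s.real 0) (s'.nat 6 (v + v)) (s'.nat 6 (v + v + 1))) ∧
    ∀ p, 2 ^ D ≤ p → s'.nat 6 p = s.nat 6 p) ?_ (fun _ _ h => h.1) ?_).mono ?_ ?_
  · exact ⟨Nat.zero_le _, hv, h, fun _ _ => rfl⟩
  · rintro t s' hs ⟨ht, hv', hw, hp⟩ hb
    have hr : s'.real 0 = s.real 0 := hs.real 0 (by simp [Prog.realWrites])
    set v := s'.nat 8 0 with hvdef
    have hv1 : 1 ≤ v := by simpa [Test.Holds, NExpr.eval] using hb
    have htD : t < D := by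
      by_contra hcon
      rw [Nat.sub_eq_zero_of_le (not_lt.1 hcon)] at hv'
      omega
    have hpow : 2 ^ (D - t) = 2 * 2 ^ (D - (t + 1)) := by
      rw [← pow_succ']; congr 1; omega
    have hvD : v < 2 ^ D := hv'.trans_le (Nat.pow_le_pow_right (by norm_num) (by omega))
    -- Both branches of the test store the winner at `v`, so the invariant is checked once for the
    -- stored value.
    suffices H : ∀ x, x = winner (s.real 0) (s'.nat 6 (v + v)) (s'.nat 6 (v + v + 1)) →
        t + 1 ≤ D ∧ v / 2 < 2 ^ (D - (t + 1)) ∧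
        (∀ z, 1 ≤ z → z < 2 ^ D → (∀ d, v / 2 / 2 ^ d ≠ z) →
          Function.update (s'.nat 6) v x z = winner (s.real 0)
            (Function.update (s'.nat 6) v x (z + z)) (Function.update (s'.nat 6) v x (z + z + 1))) ∧
        ∀ p, 2 ^ D ≤ p → Function.update (s'.nat 6) v x p = s.nat 6 p by
      refine (Halts.of_wp ?_).mono (by decide) fun _ _ => id
      simp only [Prog.wp, Test.Holds, NExpr.eval, RExpr.eval, Mem.storeNat_nat, ← hvdef, hr]
      refine ⟨fun hc => ?_, fun hc => ?_⟩
      · refine H _ ?_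
        rw [winner, if_pos]
        by_contra hcon
        apply hc
        push Not at hcon
        refine ⟨by omega, fun hc' => ?_⟩
        exact (hcon.2 (by omega)).not_ge hc'.2
      · refine H _ ?_
        rw [winner, if_neg]
        rw [not_not] at hc
        rintro (h0 | ⟨h1, h2⟩)
        · exact hc.1 (by omega)
        · exact hc.2 ⟨by omega, h2⟩
    intro x hx
    refine ⟨htD, by omega, fun z hz hzD hd => ?_, fun p hpD => ?_⟩
    · have h0 := hd 0
      simp only [pow_zero, Nat.div_one] at h0
      rw [Function.update_of_ne (by omega : z + z ≠ v),
        Function.update_of_ne (by omega : z + z + 1 ≠ v)]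
      by_cases hzv : z = v
      · subst hzv; rw [Function.update_self, hx]
      · rw [Function.update_of_ne hzv]
        refine hw z hz hzD fun d => ?_
        cases d with
        | zero => simpa using Ne.symm hzv
        | succ d =>
          have := hd d
          rwa [Nat.div_div_eq_div_mul, ← pow_succ'] at this
    · rw [Function.update_of_ne (by omega), hp p hpD]
  · simp [Test.steps, NExpr.steps]
  · rintro s' - ⟨t, ⟨-, -, hw, hp⟩, hb⟩
    -- The walk stops at index `0`, above the root. The remaining path consists of `0` alone, so no
    -- node of the tree is exempt any more.
    have h0 : s'.nat 8 0 = 0 := by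
      simpa [Test.Holds, NExpr.eval] using hb
    exact ⟨fun v hv hvD => hw v hv hvD (by simp [h0]; omega), hp⟩

/-- Enter the player for edge `7` into the tournament. -/
def enterBody : Prog :=
  .seq (.setNat 6 (.add (nvar 5) (nvar 7)) (.add (nvar 7) (.const 1)))
    (.seq (.setNat 8 (.const 0) (.half (.add (nvar 5) (nvar 7)))) replay)

/-- Move the cost of the winner to the real array `2`, and remove the winner. -/
def removeBody : Prog :=
  .seq (.setReal 2 (nvar 7) (.read 0 (.sub (.read 6 (.const 1)) (.const 1))))
    (.seq (.setNat 8 (.const 0) (.add (nvar 5) (.sub (.read 6 (.const 1)) (.const 1))))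
      (.seq (.setNat 6 (nvar 8) (.const 0))
        (.seq (.setNat 8 (.const 0) (.half (nvar 8))) replay)))

/-- Sort the costs of the edges into the real array `2`. -/
def sort : Prog :=
  .seq (.setNat 5 (.const 0) (.const 1))
    (.seq (.while (.neg (.natLe (.read 0 (.const 3)) (nvar 5)))
        (.setNat 5 (.const 0) (.add (nvar 5) (nvar 5))))
      (.seq (forTo 7 3 enterBody) (forTo 7 3 removeBody)))

/-- `S` lists the values `w 0, …, w (m - 1)` in increasing order. -/
structure SortedValues (m : ℕ) (w S : ℕ → ℝ) : Prop where
  mono : ∀ i j, i ≤ j → j < m → S i ≤ S j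
  mem : ∀ i < m, ∃ l < m, S i = w l
  exists_eq : ∀ l < m, ∃ i < m, S i = w l

theorem half_add_path {M l v : ℕ} (hpath : ∀ d, (M + l) / 2 / 2 ^ d ≠ v) :
    v + v ≠ M + l ∧ v + v + 1 ≠ M + l := by
  have := hpath 0
  rw [pow_zero, Nat.div_one] at this
  omega

theorem halts_enter {s : Mem} {m D : ℕ} (hm : s.nat 0 3 = m) (hD : m ≤ 2 ^ D)
    (hM : s.nat 5 0 = 2 ^ D) (hT : s.nat 6 = fun _ => 0) :
    Halts (forTo 7 3 enterBody) s ((m + 1) * ((D + 1) * 80 + 36)) fun s' =>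
      Tournament (s.real 0) (2 ^ D) (s'.nat 6) ∧
        ∀ l < 2 ^ D, s'.nat 6 (2 ^ D + l) = if l < m then l + 1 else 0 := by
  refine (halts_forTo (B := (D + 1) * 80 + 20) hm (by decide) (by decide) (by decide)
    (fun t s' => Tournament (s.real 0) (2 ^ D) (s'.nat 6) ∧
      ∀ l < 2 ^ D, s'.nat 6 (2 ^ D + l) = if l < t then l + 1 else 0) ?_ ?_ ?_).mono
      (by nlinarith) fun _ _ => id
  · intro t s' v h
    simpa using h
  · rw [hT]
    refine ⟨fun v _ _ => by simp [winner], fun l _ => by simp⟩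
  · rintro t s' ht hs htt ⟨h1, h2⟩
    have hM' : s'.nat 5 0 = 2 ^ D := by rw [hs.nat 5 (by decide), hM]
    have hr : s'.real 0 = s.real 0 := hs.real 0 (by decide)
    refine (Halts.seq_wp_le (b := 10) (by decide) (B := 8 + (D + 1) * 80) ?_).mono (by omega)
      fun _ _ => id
    simp only [Prog.wp, NExpr.eval, hM', htt]
    refine Halts.seq_wp_le (by decide) ?_
    simp only [Prog.wp, NExpr.eval]
    refine (halts_replay (D := D) ?_ ?_).mono le_rfl ?_
    · simp [hM', htt]; omega
    · intro v hv hvD hpath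
      simp only [Mem.storeNat_nat, Mem.storeNat_real] at hpath ⊢
      simp [hM', htt] at hpath ⊢
      obtain ⟨e1, e2⟩ := half_add_path hpath
      rw [Function.update_of_ne (by omega), Function.update_of_ne e1, Function.update_of_ne e2, hr]
      exact h1 v hv hvD
    · rintro s'' hs'' ⟨h3, h4⟩
      simp [hr] at h3 h4
      refine ⟨h3, fun l hl => ?_⟩
      rw [h4 _ (by omega)]
      by_cases hlt : l = t
      · simp [hlt]
      · rw [Function.update_of_ne (by omega), h2 l hl]
        congr 1
        simp; omega

/-- Selection sort: `A` is the set of players still in the tree. The invariant keeps every value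
already output below all costs in `A`, so appending the minimum of `A` preserves monotonicity. -/
theorem halts_remove {s : Mem} {m D : ℕ} (hm : s.nat 0 3 = m) (hD : m ≤ 2 ^ D)
    (hM : s.nat 5 0 = 2 ^ D) (hT : Tournament (s.real 0) (2 ^ D) (s.nat 6))
    (hl : ∀ l < 2 ^ D, s.nat 6 (2 ^ D + l) = if l < m then l + 1 else 0) :
    Halts (forTo 7 3 removeBody) s ((m + 1) * ((D + 1) * 80 + 56)) fun s' =>
      SortedValues m (s.real 0) (s'.real 2) := by
  refine (halts_forTo (B := (D + 1) * 80 + 40) hm (by decide) (by decide) (by decide)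
    (fun t s' => Tournament (s.real 0) (2 ^ D) (s'.nat 6) ∧ ∃ A : Finset ℕ,
      A ⊆ Finset.range m ∧ A.card + t = m ∧
      (∀ l < 2 ^ D, s'.nat 6 (2 ^ D + l) = if l ∈ A then l + 1 else 0) ∧
      (∀ i j, i ≤ j → j < t → s'.real 2 i ≤ s'.real 2 j) ∧
      (∀ i < t, ∃ l < m, s'.real 2 i = s.real 0 l) ∧
      (∀ l < m, l ∉ A → ∃ i < t, s'.real 2 i = s.real 0 l) ∧
      ∀ i < t, ∀ l ∈ A, s'.real 2 i ≤ s.real 0 l) ?_ ?_ ?_).mono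
      (by nlinarith) ?_
  · intro t s' v h
    simpa using h
  · refine ⟨hT, Finset.range m, subset_rfl, by simp, fun l h => ?_, ?_⟩
    · simp [hl l h]
    · simp
  · rintro t s' ht hs htt ⟨h1, A, hA, hcard, hleaf, hmono, hmem, hex, hle⟩
    have hM' : s'.nat 5 0 = 2 ^ D := by rw [hs.nat 5 (by decide), hM]
    have hr : s'.real 0 = s.real 0 := hs.real 0 (by decide)
    obtain ⟨l₀, hl₀⟩ : A.Nonempty := Finset.card_pos.1 (by omega)
    have hAD : ∀ l ∈ A, l < 2 ^ D := fun l h => (Finset.mem_range.1 (hA h)).trans_le hD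
    have hroot : ∀ l ∈ A, s'.nat 6 1 ≠ 0 ∧ s.real 0 (s'.nat 6 1 - 1) ≤ s.real 0 l := by
      intro l h
      have := h1.root_le (hAD l h) (by simp [hleaf l (hAD l h), h])
      simpa [hleaf l (hAD l h), h] using this
    -- The root repeats the entry of some leaf, and it is not `0` because a player is left; so it
    -- names a member of `A`.
    obtain ⟨z, hz, hzA⟩ : ∃ z, s'.nat 6 1 = z + 1 ∧ z ∈ A := by
      have hpos : 0 < 2 ^ D := by positivity
      obtain ⟨l, hlD, e⟩ := h1.exists_leaf 1 le_rfl (by omega)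
      rw [hleaf l hlD] at e
      split_ifs at e with h
      · exact ⟨l, e.symm, h⟩
      · exact absurd e.symm (hroot l₀ hl₀).1
    have hzmin : ∀ l ∈ A, s.real 0 z ≤ s.real 0 l := fun l h => by
      simpa [hz] using (hroot l h).2
    have hzD := hAD z hzA
    have hzm := Finset.mem_range.1 (hA hzA)
    refine (Halts.seq_wp_le (b := 10) (by decide) (B := 10 + (10 + (10 + (D + 1) * 80))) ?_).mono
      (by omega) fun _ _ => id
    simp only [Prog.wp, NExpr.eval, RExpr.eval, htt, hz, hr, Nat.add_sub_cancel]
    refine Halts.seq_wp_le (by decide) ?_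
    simp only [Prog.wp, NExpr.eval, Mem.storeReal_nat, hM', hz, Nat.add_sub_cancel]
    refine Halts.seq_wp_le (by decide) ?_
    simp only [Prog.wp, NExpr.eval]
    refine Halts.seq_wp_le (by decide) ?_
    simp only [Prog.wp, NExpr.eval]
    refine (halts_replay (D := D) ?_ ?_).mono le_rfl ?_
    · simp; omega
    · intro v hv hvD hpath
      simp at hpath ⊢
      obtain ⟨e1, e2⟩ := half_add_path hpath
      rw [Function.update_of_ne (by omega), Function.update_of_ne e1, Function.update_of_ne e2, hr]
      exact h1 v hv hvD
    · rintro s'' hs'' ⟨h3, h4⟩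
      have h2 := hs''.real 2 (by decide)
      simp [hr] at h2 h3 h4
      refine ⟨h3, A.erase z, (Finset.erase_subset _ _).trans hA, ?_, ?_, ?_, ?_, ?_, ?_⟩
      · rw [Finset.card_erase_of_mem hzA]
        have := Finset.card_pos.2 ⟨z, hzA⟩
        omega
      · intro l hlD
        rw [h4 _ (by omega)]
        by_cases hlz : l = z
        · simp [hlz]
        · rw [Function.update_of_ne (by omega), hleaf l hlD]
          simp [hlz]
      · intro i j hij hj
        rw [h2]
        by_cases hjt : j = t
        · subst hjt
          rw [Function.update_self]
          by_cases hit : i = j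
          · simp [hit]
          · rw [Function.update_of_ne hit]
            exact hle i (by omega) z hzA
        · rw [Function.update_of_ne hjt, Function.update_of_ne (by omega)]
          exact hmono i j hij (by omega)
      · intro i hi
        rw [h2]
        by_cases hit : i = t
        · exact ⟨z, hzm, by simp [hit]⟩
        · rw [Function.update_of_ne hit]
          exact hmem i (by omega)
      · intro l hlm hlA
        rw [h2]
        by_cases hlz : l = z
        · exact ⟨t, by omega, by simp [hlz]⟩
        · obtain ⟨i, hi, e⟩ := hex l hlm fun h => hlA (Finset.mem_erase.2 ⟨hlz, h⟩)
          exact ⟨i, by omega, by rw [Function.update_of_ne (by omega), e]⟩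
      · intro i hi l hlA
        have hlA' := Finset.mem_of_mem_erase hlA
        rw [h2]
        by_cases hit : i = t
        · rw [hit, Function.update_self]
          exact hzmin l hlA'
        · rw [Function.update_of_ne hit]
          exact hle i (by omega) l hlA'
  · rintro s' - ⟨-, A, -, hcard, -, hmono, hmem, hex, -⟩
    have hA : A = ∅ := Finset.card_eq_zero.1 (by omega)
    exact ⟨hmono, hmem, fun l h => hex l h (by simp [hA])⟩

theorem halts_sort {s : Mem} {m : ℕ} (hm : s.nat 0 3 = m) (hT : s.nat 6 = fun _ => 0) :
    Halts sort s ((m + 1) * (Nat.log 2 m + 2) * 300) fun s' =>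
      SortedValues m (s.real 0) (s'.real 2) := by
  have hfin : Halts (.seq (.while (.neg (.natLe (.read 0 (.const 3)) (nvar 5)))
        (.setNat 5 (.const 0) (.add (nvar 5) (nvar 5))))
      (.seq (forTo 7 3 enterBody) (forTo 7 3 removeBody))) (s.storeNat 5 0 1)
      (((Nat.log 2 m + 1) + 1) * 20 +
        ((m + 1) * ((Nat.log 2 m + 1 + 1) * 80 + 36) + (m + 1) * ((Nat.log 2 m + 1 + 1) * 80 + 56)))
      fun s' => SortedValues m (s.real 0) (s'.real 2) := by
    -- The size of the tree doubles until it is at least `m`. Each doubling starts from `2 ^ t < m`,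
    -- so the exponent ends at most at `Nat.log 2 m + 1`.
    refine (Halts.mono (B' := ((Nat.log 2 m + 1) + 1) * 20) (Halts.loop
      (N := Nat.log 2 m + 1) (B := 7) (fun t s' => s'.nat 5 0 = 2 ^ t ∧ t ≤ Nat.log 2 m + 1) ?_ (fun _ _ h => h.2) ?_) ?_ fun _ _ => id).seq ?_
    · simp
    · rintro t s' hs ⟨h1, h2⟩ hb
      have h0 : s'.nat 0 3 = m := by rw [hs.nat 0 (by decide)]; simpa using hm
      have hlt : 2 ^ t < m := by simpa [Test.Holds, NExpr.eval, h0, h1] using hb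
      refine (Halts.of_wp ?_).mono (by decide) fun _ _ => id
      simp [Prog.wp, NExpr.eval, h1, pow_succ, mul_two]
      exact Nat.le_log_of_pow_le (by norm_num) hlt.le
    · simp [Test.steps, NExpr.steps]
    · rintro s' hs ⟨D, ⟨h1, hD⟩, hb⟩
      have h0 : s'.nat 0 3 = m := by rw [hs.nat 0 (by decide)]; simpa using hm
      have hT' : s'.nat 6 = fun _ => 0 := by rw [hs.nat 6 (by decide)]; simpa using hT
      have hr' : s'.real 0 = s.real 0 := by rw [hs.real 0 (by decide)]; simp
      have hmD : m ≤ 2 ^ D := by simpa [Test.Holds, NExpr.eval, h0, h1] using hb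
      refine ((halts_enter h0 hmD h1 hT').seq fun s'' hs'' h'' => ?_).mono
        (B := (m + 1) * ((D + 1) * 80 + 36) + (m + 1) * ((D + 1) * 80 + 56)) (by gcongr)
        fun _ _ => id
      have hr'' : s''.real 0 = s.real 0 := by rw [hs''.real 0 (by decide), hr']
      rw [hr', ← hr''] at h''
      rw [← hr'']
      exact halts_remove (by rw [hs''.nat 0 (by decide), h0]) hmD
        (by rw [hs''.nat 5 (by decide), h1]) h''.1 h''.2
  refine (Halts.seq_wp (p := .setNat 5 (.const 0) (.const 1)) hfin).mono ?_ fun _ _ => id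
  simp only [Prog.cost, NExpr.steps]
  have : 1 ≤ m + 1 := by omega
  nlinarith [Nat.zero_le (m * Nat.log 2 m)]

end KMedian

namespace KMedian

/-! ## The search for the best center at a threshold -/

variable {u n k : ℕ} {c : Fin u → Fin n → ℝ≥0∞}

/-- The edges of `c` are the pairs `(ctr l, cust l)`, `l < m`, and their costs are `w l`. -/
structure EdgeList (c : Fin u → Fin n → ℝ≥0∞) (m : ℕ) (ctr cust : ℕ → ℕ) (w : ℕ → ℝ) : Prop where
  mem : ∀ l < m, ∃ (i : Fin u) (j : Fin n),
    ctr l = i ∧ cust l = j ∧ c i j ≠ ⊤ ∧ w l = (c i j).toReal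
  exists_eq : ∀ (i : Fin u) (j : Fin n), c i j ≠ ⊤ → ∃ l < m, ctr l = i ∧ cust l = j
  inj : ∀ l < m, ∀ l' < m, ctr l = ctr l' → cust l = cust l' → l = l'

theorem EdgeList.cost_eq {m : ℕ} {ctr cust : ℕ → ℕ} {w : ℕ → ℝ} (h : EdgeList c m ctr cust w)
    {l : ℕ} (hl : l < m) {i : Fin u} {j : Fin n} (hi : ctr l = i) (hj : cust l = j) :
    c i j ≠ ⊤ ∧ w l = (c i j).toReal := by
  obtain ⟨i', j', h1, h2, h3⟩ := h.mem l hl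
  obtain rfl : i = i' := Fin.ext (hi.symm.trans h1)
  obtain rfl : j = j' := Fin.ext (hj.symm.trans h2)
  exact h3

/-- The edges at `i` correspond bijectively to the customers with finite cost to `i`; injectivity of
the list excludes double counting. -/
theorem EdgeList.sum_eq {m : ℕ} {ctr cust : ℕ → ℕ} {w : ℕ → ℝ} (h : EdgeList c m ctr cust w)
    (i : Fin u) (g : ℕ → ℝ → ℝ) :
    ∑ l ∈ Finset.range m, (if ctr l = i then g (cust l) (w l) else 0) =
      ∑ j : Fin n, if c i j ≠ ⊤ then g j (c i j).toReal else 0 := by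
  rw [← Finset.sum_filter, ← Finset.sum_filter]
  symm
  refine Finset.sum_bij
    (fun j hj => (h.exists_eq i j (by simpa using hj)).choose) ?_ ?_ ?_ ?_
  · intro j hj
    obtain ⟨h1, h2, -⟩ := (h.exists_eq i j (by simpa using hj)).choose_spec
    simp [h1, h2]
  · intro j hj j' hj' e
    obtain ⟨-, -, h2⟩ := (h.exists_eq i j (by simpa using hj)).choose_spec
    obtain ⟨-, -, h2'⟩ := (h.exists_eq i j' (by simpa using hj')).choose_spec
    exact Fin.ext (h2.symm.trans ((congrArg cust e).trans h2'))
  · intro l hl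
    simp only [Finset.mem_filter, Finset.mem_range] at hl
    obtain ⟨i', j, h1, h2, h3, -⟩ := h.mem l hl.1
    obtain rfl : i' = i := Fin.ext (h1.symm.trans hl.2)
    refine ⟨j, by simpa using h3, ?_⟩
    obtain ⟨h4, h5, h6⟩ := (h.exists_eq i' j h3).choose_spec
    exact h.inj _ h4 _ hl.1 (h5.trans h1.symm) (h6.trans h2.symm)
  · intro j hj
    obtain ⟨h1, h2, h3⟩ := (h.exists_eq i j (by simpa using hj)).choose_spec
    rw [h3, (h.cost_eq h1 h2 h3).2]

/-- Adding `i` changes only the distances of its neighbors. So the sums for all the sets `insert i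
C` arise from one sum for `C` by a single pass over the edges. -/
theorem EdgeList.sum_dist_insert {m : ℕ} {ctr cust : ℕ → ℕ} {w d : ℕ → ℝ} {big : ℝ}
    {C : Finset (Fin u)} (h : EdgeList c m ctr cust w)
    (hbig : ∀ i j, c i j ≠ ⊤ → c i j ≤ ENNReal.ofReal big) (hd : ∀ j : Fin n, d j = dist c big C j)
    (φ : ℝ → ℝ) (i : Fin u) :
    ∑ j, φ (dist c big (insert i C) j) = ∑ j, φ (dist c big C j) +
      ∑ l ∈ Finset.range m, if ctr l = i then φ (min (d (cust l)) (w l)) - φ (d (cust l)) else 0 := by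
  rw [h.sum_eq i fun j x => φ (min (d j) x) - φ (d j), ← Finset.sum_add_distrib]
  refine Finset.sum_congr rfl fun j _ => ?_
  rw [dist_insert, hd]
  split_ifs with hc
  · rw [trunc_of_le (hbig i j hc)]; ring
  · rw [not_not] at hc
    have hle : dist c big C j ≤ trunc big ⊤ := trunc_mono big le_top
    rw [hc, min_eq_left hle, add_zero]

/-- The memory holds the instance and the connection costs to `C`. -/
structure Ready (k : ℕ) (c : Fin u → Fin n → ℝ≥0∞) (m : ℕ) (big : ℝ) (C : Finset (Fin u))
    (s : Mem) : Prop where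
  edges : EdgeList c m (s.nat 1) (s.nat 2) (s.real 0)
  k_eq : s.nat 0 0 = k
  n_eq : s.nat 0 2 = n
  m_eq : s.nat 0 3 = m
  dist_eq : ∀ j : Fin n, s.real 3 j = dist c big C j

theorem Ready.congr {m : ℕ} {big : ℝ} {C : Finset (Fin u)} {s s' : Mem}
    (h : Ready k c m big C s) (h0 : s'.nat 0 = s.nat 0) (h1 : s'.nat 1 = s.nat 1)
    (h2 : s'.nat 2 = s.nat 2) (h3 : s'.real 0 = s.real 0) (h4 : s'.real 3 = s.real 3) :
    Ready k c m big C s' := by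
  obtain ⟨a, b, c, d, e⟩ := h
  constructor
  · rwa [h1, h2, h3]
  · rwa [h0]
  · rwa [h0]
  · rwa [h0]
  · rwa [h4]

/-- Sum up the connection costs at the threshold in the real scalar `11`. -/
def baseSums : Prog :=
  .seq (.setReal 6 (.const 0) (.ofNat (.const 0)))
    (.seq (.setReal 7 (.const 0) (.ofNat (.const 0)))
      (forTo 9 2 (.ite (.realLe (.read 3 (nvar 9)) (rvar 11))
        (.setReal 7 (.const 0) (.add (rvar 7) (.read 3 (nvar 9))))
        (.setReal 6 (.const 0) (.add (rvar 6) (.ofNat (.const 1)))))))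

theorem halts_baseSums {m : ℕ} {big : ℝ} {C : Finset (Fin u)} {s : Mem}
    (h : Ready k c m big C s) :
    Halts baseSums s ((n + 1) * 50) fun s' =>
      s'.real 6 0 = excessSum c big (s.real 11 0) C ∧
      s'.real 7 0 = withinSum c big (s.real 11 0) C := by
  refine Halts.mono (B := 4 + (4 + (n + 1) * (20 + 16))) (Halts.seq_wp_le (by decide) ?_)
    (by omega) fun _ _ => id
  simp only [Prog.wp, NExpr.eval, RExpr.eval]
  refine Halts.seq_wp_le (by decide) ?_
  simp only [Prog.wp, NExpr.eval, RExpr.eval]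
  refine (halts_forTo (N := n) (by simpa using h.n_eq) (by decide) (by decide) (by decide)
    (fun t s' => s'.real 6 0 = ∑ l ∈ Finset.range t, excess (s.real 11 0) (s.real 3 l) ∧
      s'.real 7 0 = ∑ l ∈ Finset.range t, within (s.real 11 0) (s.real 3 l)) ?_ ?_ ?_).mono
      le_rfl ?_
  · intro t s' v h; simpa using h
  · simp
  · rintro t s' ht hs htt ⟨h1, h2⟩
    have h3 : s'.real 3 = s.real 3 := by rw [hs.real 3 (by decide)]; simp
    have h11 : s'.real 11 = s.real 11 := by rw [hs.real 11 (by decide)]; simp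
    refine (Halts.of_wp ?_).mono (by decide) fun _ _ => id
    simp only [Prog.wp, Test.Holds, NExpr.eval, RExpr.eval, htt, h3, h11]
    refine ⟨fun hb => ?_, fun hb => ?_⟩
    · simp [Finset.sum_range_succ, h1, h2, excess, within, hb]
    · simp [Finset.sum_range_succ, h1, h2, excess, within, hb]
  · rintro s' - ⟨h1, h2⟩
    rw [h1, h2, Finset.sum_range, Finset.sum_range]
    simp only [h.dist_eq]
    exact ⟨rfl, rfl⟩

/-- Initialize the sums of every center of an edge. -/
def resetSums : Prog :=
  forTo 9 3 (.seq (.setReal 4 (.read 1 (nvar 9)) (rvar 6)) (.setReal 5 (.read 1 (nvar 9)) (rvar 7)))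

/-- Running over edges instead of centers keeps the time `O(m)`; repeated writes to the same center
store the same values. -/
theorem halts_resetSums {m : ℕ} {s : Mem} (hm : s.nat 0 3 = m) :
    Halts resetSums s ((m + 1) * 50) fun s' => ∀ l < m,
      s'.real 4 (s.nat 1 l) = s.real 6 0 ∧ s'.real 5 (s.nat 1 l) = s.real 7 0 := by
  refine (halts_forTo (B := 30) hm (by decide) (by decide) (by decide)
    (fun t s' => ∀ l < t, s'.real 4 (s.nat 1 l) = s.real 6 0 ∧ s'.real 5 (s.nat 1 l) = s.real 7 0)
    ?_ ?_ ?_).mono (by omega) fun _ _ => id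
  · intro t s' v h; simpa using h
  · simp
  · intro t s' ht hs htt hi
    have h1 : s'.nat 1 = s.nat 1 := hs.nat 1 (by decide)
    have h6 : s'.real 6 = s.real 6 := hs.real 6 (by decide)
    have h7 : s'.real 7 = s.real 7 := hs.real 7 (by decide)
    refine (Halts.of_wp ?_).mono (by decide) fun _ _ => id
    simp [Prog.wp, NExpr.eval, RExpr.eval, htt, h1, h6, h7]
    intro l hl
    by_cases he : s.nat 1 l = s.nat 1 t
    · simp [he]
    · rw [Function.update_of_ne he, Function.update_of_ne he]
      exact hi l (lt_of_le_of_ne (by omega) fun h => he (by rw [h]))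

/-- Account for edge `9` in the sums of its center. -/
def correctBody : Prog :=
  .ite (.realLe (.read 0 (nvar 9)) (.read 3 (.read 2 (nvar 9))))
    (.ite (.realLe (.read 3 (.read 2 (nvar 9))) (rvar 11))
      (.setReal 5 (.read 1 (nvar 9)) (.add (.read 5 (.read 1 (nvar 9)))
        (.sub (.read 0 (nvar 9)) (.read 3 (.read 2 (nvar 9))))))
      (.ite (.realLe (.read 0 (nvar 9)) (rvar 11))
        (.seq (.setReal 5 (.read 1 (nvar 9))
            (.add (.read 5 (.read 1 (nvar 9))) (.read 0 (nvar 9))))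
          (.setReal 4 (.read 1 (nvar 9))
            (.sub (.read 4 (.read 1 (nvar 9))) (.ofNat (.const 1)))))
        .skip))
    .skip

/-- The change of a sum of values `φ` by the first `t` edges of the center `z`. -/
noncomputable def correction (s : Mem) (φ : ℝ → ℝ) (t z : ℕ) : ℝ :=
  ∑ l ∈ Finset.range t, if s.nat 1 l = z then
    φ (min (s.real 3 (s.nat 2 l)) (s.real 0 l)) - φ (s.real 3 (s.nat 2 l)) else 0

/-- If the new cost `w` is at most the old distance `d`, there are three cases: for `d ≤ L` the
inner sum changes by `w - d`; for `w ≤ L < d` the customer moves from the count to the sum; for `w >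
L` nothing changes. -/
theorem halts_correctBody {s : Mem} {l : ℕ} (hl : s.nat 9 0 = l) :
    Halts correctBody s 80 fun s' =>
      (∀ z, s'.real 4 z = s.real 4 z + if s.nat 1 l = z then
        excess (s.real 11 0) (min (s.real 3 (s.nat 2 l)) (s.real 0 l)) -
          excess (s.real 11 0) (s.real 3 (s.nat 2 l)) else 0) ∧
      ∀ z, s'.real 5 z = s.real 5 z + if s.nat 1 l = z then
        within (s.real 11 0) (min (s.real 3 (s.nat 2 l)) (s.real 0 l)) -
          within (s.real 11 0) (s.real 3 (s.nat 2 l)) else 0 := by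
  refine (Halts.of_wp ?_).mono (by decide) fun _ _ => id
  simp only [correctBody, Prog.wp, Test.Holds, NExpr.eval, RExpr.eval, hl]
  set d := s.real 3 (s.nat 2 l)
  set w := s.real 0 l
  set L := s.real 11 0
  set i := s.nat 1 l
  refine ⟨fun h1 => ⟨fun h2 => ?_, fun h2 => ⟨fun h3 => ?_, fun h3 => ?_⟩⟩, fun h1 => ?_⟩
  · have h3 : w ≤ L := h1.trans h2
    simp only [min_eq_right h1, excess, within, if_pos h2, if_pos h3]
    constructor <;> intro z <;> by_cases hz : i = z
    · simp
    · simp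
    · subst hz; simp
    · simp [hz, Function.update_of_ne (Ne.symm hz)]
  · simp only [min_eq_right h1, excess, within, if_neg h2, if_pos h3]
    constructor <;> intro z <;> by_cases hz : i = z
    · subst hz; simp [hl, i, sub_eq_add_neg]
    · have hz' : z ≠ s.nat 1 l := Ne.symm hz
      simp [hl, hz, Function.update_of_ne hz']
    · subst hz; simp
    · simp [hz, Function.update_of_ne (Ne.symm hz)]
  · simp [min_eq_right h1, excess, within, if_neg h2, if_neg h3]
  · simp [min_eq_left (not_le.1 h1).le]

theorem halts_correct {m : ℕ} {s : Mem} (hm : s.nat 0 3 = m) :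
    Halts (forTo 9 3 correctBody) s ((m + 1) * 100) fun s' => ∀ z,
      s'.real 4 z = s.real 4 z + correction s (excess (s.real 11 0)) m z ∧
      s'.real 5 z = s.real 5 z + correction s (within (s.real 11 0)) m z := by
  refine (halts_forTo (B := 80) hm (by decide) (by decide) (by decide)
    (fun t s' => ∀ z, s'.real 4 z = s.real 4 z + correction s (excess (s.real 11 0)) t z ∧
      s'.real 5 z = s.real 5 z + correction s (within (s.real 11 0)) t z)
    ?_ ?_ ?_).mono (by omega) fun _ _ => id
  · intro t s' v h; simpa using h
  · simp [correction]
  · intro t s' ht hs htt hi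
    refine (halts_correctBody htt).mono le_rfl ?_
    rw [hs.nat 1 (by decide), hs.nat 2 (by decide), hs.real 0 (by decide), hs.real 3 (by decide),
      hs.real 11 (by decide)]
    rintro s'' - ⟨h4, h5⟩ z
    rw [h4, h5, (hi z).1, (hi z).2, correction, correction, correction, correction,
      Finset.sum_range_succ, Finset.sum_range_succ, add_assoc, add_assoc]
    exact ⟨rfl, rfl⟩

/-- Compare the center of edge `9` with the best one so far. -/
def selectBody : Prog :=
  .ite (.conj (.realLe (.read 4 (.read 1 (nvar 9))) (rvar 8))
      (.conj (.neg (.conj (.realLe (rvar 8) (.read 4 (.read 1 (nvar 9))))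
          (.neg (.realLe (.read 5 (.read 1 (nvar 9))) (.ofNat (.const 0))))))
        (.neg (.conj (.natLe (.const 1) (nvar 12))
          (.realLe (rvar 9) (.div (.read 5 (.read 1 (nvar 9)))
            (.sub (rvar 8) (.read 4 (.read 1 (nvar 9))))))))))
    (.seq (.setNat 12 (.const 0) (.const 1))
      (.seq (.setNat 13 (.const 0) (.read 1 (nvar 9)))
        (.setReal 9 (.const 0) (.div (.read 5 (.read 1 (nvar 9)))
          (.sub (rvar 8) (.read 4 (.read 1 (nvar 9))))))))
    .skip

/-- Find the best center of an edge. -/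
def select : Prog :=
  .seq (.setNat 12 (.const 0) (.const 0))
    (.seq (.setNat 13 (.const 0) (.read 1 (.const 0))) (forTo 9 3 selectBody))

/-- The candidate starts as the center of the first edge, so a valid center is named even if none
reaches the target; the parameter then becomes `∞`, where every center qualifies. -/
theorem halts_select {m : ℕ} {s : Mem} {τ : ℝ} {A B : ℕ → ℝ} (hm : s.nat 0 3 = m) (h0 : 0 < m)
    (hτ : s.real 8 0 = τ) (hA : s.real 4 = A) (hB : s.real 5 = B) :
    Halts select s ((m + 1) * 120) fun s' =>
      (∃ l < m, s.nat 1 l = s'.nat 13 0 ∧ (s'.nat 12 0 ≠ 0 →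
        Reaches τ (A (s.nat 1 l)) (B (s.nat 1 l)) ∧
          s'.real 9 0 = B (s.nat 1 l) / (τ - A (s.nat 1 l)))) ∧
      ∀ l < m, Reaches τ (A (s.nat 1 l)) (B (s.nat 1 l)) →
        s'.nat 12 0 ≠ 0 ∧ s'.real 9 0 ≤ B (s.nat 1 l) / (τ - A (s.nat 1 l)) := by
  refine Halts.mono (B := 3 + (4 + (m + 1) * (90 + 16))) (Halts.seq_wp_le (by decide) ?_)
    (by omega) fun _ _ => id
  simp only [Prog.wp, NExpr.eval]
  refine Halts.seq_wp_le (by decide) ?_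
  simp only [Prog.wp, NExpr.eval]
  refine (halts_forTo (N := m) (by simpa using hm) (by decide) (by decide) (by decide)
    (fun t s' => (∃ l < m, s.nat 1 l = s'.nat 13 0 ∧ (s'.nat 12 0 ≠ 0 →
        Reaches τ (A (s.nat 1 l)) (B (s.nat 1 l)) ∧
          s'.real 9 0 = B (s.nat 1 l) / (τ - A (s.nat 1 l)))) ∧
      ∀ l < t, Reaches τ (A (s.nat 1 l)) (B (s.nat 1 l)) →
        s'.nat 12 0 ≠ 0 ∧ s'.real 9 0 ≤ B (s.nat 1 l) / (τ - A (s.nat 1 l))) ?_ ?_ ?_).mono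
      le_rfl fun _ _ => id
  · intro t s' v h; simpa using h
  · exact ⟨⟨0, h0, by simp, by simp⟩, by simp⟩
  · rintro t s' ht hs htt ⟨h1, h2⟩
    have e1 : s'.nat 1 = s.nat 1 := by rw [hs.nat 1 (by decide)]; simp
    have e4 : s'.real 4 = A := by rw [hs.real 4 (by decide), ← hA]; simp
    have e5 : s'.real 5 = B := by rw [hs.real 5 (by decide), ← hB]; simp
    have e8 : s'.real 8 0 = τ := by rw [hs.real 8 (by decide), ← hτ]; simp
    refine (Halts.of_wp ?_).mono (by decide) fun _ _ => id
    simp [selectBody, Prog.wp, Test.Holds, NExpr.eval, RExpr.eval, htt, e1, e4, e5, e8]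
    set z := s.nat 1 t
    refine ⟨fun hr1 hr2 hv => ?_, fun hneg => ⟨h1, fun l hl hr => ?_⟩⟩
    · refine ⟨⟨t, ht, rfl, ⟨hr1, ?_⟩, rfl⟩, fun l hl hr => ?_⟩
      · by_contra! hcon
        exact absurd (hr2 hcon.1) hcon.2.not_ge
      · rcases Nat.lt_succ_iff_lt_or_eq.1 (by omega : l < t + 1) with hlt | rfl
        · obtain ⟨h3, h4⟩ := h2 l hlt hr
          exact (hv (by omega)).le.trans h4
        · exact le_rfl
    · rcases Nat.lt_succ_iff_lt_or_eq.1 (by omega : l < t + 1) with hlt | rfl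
      · exact h2 l hlt hr
      · have := hneg hr.1 fun hle => hr.2.resolve_left hle.not_gt
        exact ⟨by omega, this.2⟩

/-- Find the best center at the threshold in the real scalar `11`. -/
def search : Prog :=
  .seq baseSums (.seq resetSums (.seq (forTo 9 3 correctBody) select))

theorem halts_search {m : ℕ} {big : ℝ} {C : Finset (Fin u)} {s : Mem} (h : Ready k c m big C s)
    (hm : 0 < m) (hn : n ≤ m)
    (hbig : ∀ i j, c i j ≠ ⊤ → c i j ≤ ENNReal.ofReal big) :
    Halts search s ((m + 1) * 320) fun s' =>
      BestAt c C big (s.real 8 0) (s.real 11 0) (s'.nat 12 0) (s'.real 9 0) (s'.nat 13 0) := by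
  refine Halts.mono (B := (n + 1) * 50 + ((m + 1) * 50 + ((m + 1) * 100 + (m + 1) * 120)))
    ((halts_baseSums h).seq ?_) (by omega) fun _ _ => id
  rintro s₁ hs₁ ⟨h6, h7⟩
  have hm₁ : s₁.nat 0 3 = m := by rw [hs₁.nat 0 (by decide), h.m_eq]
  refine (halts_resetSums hm₁).seq ?_
  intro s₂ hs₂ hr
  have hm₂ : s₂.nat 0 3 = m := by rw [hs₂.nat 0 (by decide), hm₁]
  refine (halts_correct hm₂).seq ?_
  intro s₃ hs₃ hc
  have hm₃ : s₃.nat 0 3 = m := by rw [hs₃.nat 0 (by decide), hm₂]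
  refine (halts_select hm₃ hm rfl rfl rfl).mono le_rfl ?_
  have e1 : s₃.nat 1 = s.nat 1 := by
    rw [hs₃.nat 1 (by decide), hs₂.nat 1 (by decide), hs₁.nat 1 (by decide)]
  have e8 : s₃.real 8 = s.real 8 := by
    rw [hs₃.real 8 (by decide), hs₂.real 8 (by decide), hs₁.real 8 (by decide)]
  have hcor : ∀ φ t z, correction s₂ φ t z = correction s φ t z := by
    intro φ t z
    rw [correction, correction, hs₂.nat 1 (by decide), hs₁.nat 1 (by decide),
      hs₂.nat 2 (by decide), hs₁.nat 2 (by decide), hs₂.real 0 (by decide), hs₁.real 0 (by decide),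
      hs₂.real 3 (by decide), hs₁.real 3 (by decide)]
  have e11 : s₂.real 11 = s.real 11 := by
    rw [hs₂.real 11 (by decide), hs₁.real 11 (by decide)]
  have e1' : s₁.nat 1 = s.nat 1 := hs₁.nat 1 (by decide)
  have key : ∀ l < m, ∀ i : Fin u, s.nat 1 l = i →
      s₃.real 4 (s.nat 1 l) = excessSum c big (s.real 11 0) (insert i C) ∧
      s₃.real 5 (s.nat 1 l) = withinSum c big (s.real 11 0) (insert i C) := by
    intro l hl i hi
    obtain ⟨r4, r5⟩ := hr l hl
    rw [e1'] at r4 r5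
    rw [(hc _).1, (hc _).2, r4, r5, h6, h7, hcor, hcor, e11, hi]
    exact ⟨(h.edges.sum_dist_insert hbig h.dist_eq _ i).symm,
      (h.edges.sum_dist_insert hbig h.dist_eq _ i).symm⟩
  rintro s₄ - ⟨⟨l, hl, hz, hv⟩, hleast⟩
  rw [e1, e8] at *
  obtain ⟨i, j, hi, -, hj, -⟩ := h.edges.mem l hl
  refine ⟨⟨i, ⟨j, hj⟩, hi.symm.trans hz, fun hf => ?_⟩, ?_⟩
  · have := hv hf
    rwa [(key l hl i hi).1, (key l hl i hi).2] at this
  · rintro i ⟨j, hj⟩ hreach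
    obtain ⟨l, hl, hi, -⟩ := h.edges.exists_eq i j hj
    have := hleast l hl
    rw [(key l hl i hi).1, (key l hl i hi).2] at this
    exact this hreach

end KMedian

namespace KMedian

/-! ## One iteration -/

variable {u n k : ℕ} {c : Fin u → Fin n → ℝ≥0∞}

section Breakpoints

variable {m : ℕ} {ctr cust : ℕ → ℕ} {w S : ℕ → ℝ}

theorem EdgeList.breakpoint_nonneg (h : EdgeList c m ctr cust w) (hS : SortedValues m w S) {x : ℕ}
    (hx : x < m) : 0 ≤ S x := by
  obtain ⟨l, hl, e⟩ := hS.mem x hx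
  obtain ⟨i, j, -, -, -, e'⟩ := h.mem l hl
  rw [e, e']
  exact ENNReal.toReal_nonneg

theorem EdgeList.exists_breakpoint (h : EdgeList c m ctr cust w) (hS : SortedValues m w S)
    {i : Fin u} {j : Fin n} (hc : c i j ≠ ⊤) : ∃ x < m, c i j = ENNReal.ofReal (S x) := by
  obtain ⟨l, hl, h1, h2⟩ := h.exists_eq i j hc
  obtain ⟨x, hx, e⟩ := hS.exists_eq l hl
  exact ⟨x, hx, by rw [e, (h.cost_eq hl h1 h2).2, ENNReal.ofReal_toReal hc]⟩

theorem EdgeList.le_last (h : EdgeList c m ctr cust w) (hS : SortedValues m w S)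
    {i : Fin u} {j : Fin n} (hc : c i j ≠ ⊤) : c i j ≤ ENNReal.ofReal (S (m - 1)) := by
  obtain ⟨x, hx, e⟩ := h.exists_breakpoint hS hc
  rw [e]
  exact ENNReal.ofReal_le_ofReal (hS.mono _ _ (by omega) (by omega))

theorem EdgeList.split_succ (h : EdgeList c m ctr cust w) (hS : SortedValues m w S) {x : ℕ}
    (hx : x + 1 < m) : Split c (S x) (S (x + 1)) := by
  intro i j
  refine (le_or_gt _ _).imp_right fun hlt => ⟨hlt, ?_⟩
  by_cases hc : c i j = ⊤
  · rw [hc]; exact le_top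
  · obtain ⟨y, hy, e⟩ := h.exists_breakpoint hS hc
    rw [e] at hlt ⊢
    refine ENNReal.ofReal_le_ofReal (hS.mono _ _ ?_ hy)
    by_contra! hcon
    exact hlt.not_ge (ENNReal.ofReal_le_ofReal (hS.mono _ _ (by omega) (by omega)))

/-- The threshold must stay below `big`, hence the minimum with the largest cost. Beyond that cost
there are only infinite ones, so nothing is lost. -/
theorem EdgeList.split_last (h : EdgeList c m ctr cust w) (hS : SortedValues m w S) (μ : ℝ) :
    Split c (min μ (S (m - 1))) μ := by
  intro i j
  refine (le_or_gt _ _).imp_right fun hlt => ⟨hlt, ?_⟩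
  by_cases hc : c i j = ⊤
  · rw [hc]; exact le_top
  · have hle := h.le_last hS hc
    rcases min_cases μ (S (m - 1)) with ⟨e, -⟩ | ⟨e, -⟩ <;> rw [e] at hlt
    exacts [hlt.le, absurd hle hlt.not_ge]

theorem EdgeList.split_last' (h : EdgeList c m ctr cust w) (hS : SortedValues m w S) (μ : ℝ) :
    Split c (S (m - 1)) μ := by
  have := h.split_last hS (max μ (S (m - 1)))
  rw [min_eq_right (le_max_right _ _)] at this
  exact this.mono (le_max_left _ _)

/-- A zero-cost edge makes `0` the first breakpoint, so every parameter `μ ≥ 0` has a breakpoint at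
or below it. -/
theorem EdgeList.breakpoint_zero (h : EdgeList c m ctr cust w) (hS : SortedValues m w S)
    (hA : Admissible k c) : 0 < m ∧ S 0 = 0 := by
  have hn : 0 < n := by exact_mod_cast hA.n_pos
  obtain ⟨i, hi⟩ := hA.zero_center ⟨0, hn⟩
  obtain ⟨x, hx, e⟩ := h.exists_breakpoint hS (i := i) (j := ⟨0, hn⟩) (by simp [hi])
  rw [hi, eq_comm, ENNReal.ofReal_eq_zero] at e
  refine ⟨by omega, le_antisymm ((hS.mono 0 x (by omega) hx).trans e) ?_⟩
  exact h.breakpoint_nonneg hS (by omega)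

theorem EdgeList.le_card (h : EdgeList c m ctr cust w) (hA : Admissible k c) : n ≤ m := by
  have : (Finset.range n).card ≤ (Finset.range m).card := by
    refine Finset.card_le_card_of_surjOn cust fun j hj => ?_
    have hj' : j < n := by simpa using hj
    obtain ⟨i, hi⟩ := hA.zero_center ⟨j, hj'⟩
    obtain ⟨l, hl, -, h2⟩ := h.exists_eq i ⟨j, hj'⟩ (by simp [hi])
    exact ⟨l, by simpa using hl, h2⟩
  simpa using this

end Breakpoints

/-- Test the middle of the remaining range of breakpoints. -/
def bisectBody : Prog :=
  .seq (.setReal 11 (.const 0) (.read 2 (.half (.add (nvar 10) (nvar 11)))))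
    (.seq search
      (.ite (.conj (.natLe (.const 1) (nvar 12)) (.realLe (rvar 9) (rvar 11)))
        (.setNat 11 (.const 0) (.half (.add (nvar 10) (nvar 11))))
        (.setNat 10 (.const 0) (.add (.half (.add (nvar 10) (nvar 11))) (.const 1)))))

/-- Find the first feasible breakpoint. -/
def bisect : Prog :=
  .seq (.setNat 10 (.const 0) (.const 0))
    (.seq (.setNat 11 (.const 0) (.read 0 (.const 3)))
      (.while (.neg (.natLe (nvar 11) (nvar 10))) bisectBody))

theorem halts_bisectBody (hA : Admissible k c) {m : ℕ} {big τ : ℝ} {C : Finset (Fin u)} {s : Mem}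
    (h : Ready k c m big C s) (hS : SortedValues m (s.real 0) (s.real 2))
    (hbig : s.real 2 (m - 1) < big) (hτ : s.real 8 0 = (2 * k + 1) * τ) {lo hi mid : ℕ}
    (hlo : s.nat 10 0 = lo) (hhi : s.nat 11 0 = hi) (hmid : mid = (lo + hi) / 2) (hmm : mid < m) :
    Halts bisectBody s ((m + 1) * 350) fun s' =>
      (Feasible k c C τ (s.real 2 mid) ∧ s'.nat 10 0 = lo ∧ s'.nat 11 0 = mid) ∨
      (¬ Feasible k c C τ (s.real 2 mid) ∧ s'.nat 10 0 = mid + 1 ∧ s'.nat 11 0 = hi) := by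
  refine Halts.mono (B := 10 + ((m + 1) * 320 + 30)) (Halts.seq_wp_le (by decide) ?_)
    (by omega) fun _ _ => id
  simp only [Prog.wp, NExpr.eval, RExpr.eval, hlo, hhi, ← hmid]
  refine (halts_search (h.congr (s' := s.storeReal 11 0 (s.real 2 mid)) rfl rfl rfl rfl
    (by simp)) (by omega) (h.edges.le_card hA)
    fun i j hc => (h.edges.le_last hS hc).trans (ENNReal.ofReal_le_ofReal hbig.le)).seq ?_
  intro s' hs' hb
  simp only [Mem.storeReal_real, if_pos, Function.update_self, if_neg (by norm_num : ¬ 8 = 11), hτ]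
    at hb
  have h0 := h.edges.breakpoint_nonneg hS hmm
  have hlt : s.real 2 mid < big := (hS.mono _ _ (by omega) (by omega)).trans_lt hbig
  have hf := hb.feasible_iff hA h0 hlt (.refl _) le_rfl
  have e10 : s'.nat 10 0 = lo := by rw [hs'.nat 10 (by decide)]; exact hlo
  have e11 : s'.nat 11 0 = hi := by rw [hs'.nat 11 (by decide)]; exact hhi
  have eL : s'.real 11 0 = s.real 2 mid := by rw [hs'.real 11 (by decide)]; simp
  refine (Halts.of_wp ?_).mono (by decide) fun _ _ => id
  simp only [Prog.wp, Test.Holds, NExpr.eval, RExpr.eval, e10, e11, ← hmid, eL, hf,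
    Nat.one_le_iff_ne_zero]
  exact ⟨fun hc => .inl ⟨hc, by simp [e10], by simp⟩, fun hc => .inr ⟨hc, by simp, by simp [e11]⟩⟩

/-- Outside the range, the breakpoint just below is infeasible and the one at its upper end is
feasible, where the ends `0` and `m` count as unconstrained. After `t` rounds the range has length
at most `m / 2 ^ t`. -/
theorem halts_bisect (hA : Admissible k c) {m : ℕ} {big τ : ℝ} {C : Finset (Fin u)} {s : Mem}
    (h : Ready k c m big C s) (hS : SortedValues m (s.real 0) (s.real 2))
    (hbig : s.real 2 (m - 1) < big) (hτ : s.real 8 0 = (2 * k + 1) * τ) :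
    Halts bisect s ((m + 1) * (Nat.log 2 m + 2) * 370) fun s' =>
      s'.nat 10 0 ≤ m ∧
      (s'.nat 10 0 = 0 ∨ ¬ Feasible k c C τ (s.real 2 (s'.nat 10 0 - 1))) ∧
      (s'.nat 10 0 = m ∨ Feasible k c C τ (s.real 2 (s'.nat 10 0))) := by
  refine Halts.mono (B := 3 + (4 + (Nat.log 2 m + 1 + 1) * (7 + (m + 1) * 350)))
    (Halts.seq_wp_le (by decide) ?_) (by nlinarith [Nat.zero_le (m * Nat.log 2 m)]) fun _ _ => id
  simp only [Prog.wp, NExpr.eval]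
  refine Halts.seq_wp_le (by decide) ?_
  simp only [Prog.wp, NExpr.eval]
  have hm3 := h.m_eq
  refine (Halts.loop (N := Nat.log 2 m + 1) (B := (m + 1) * 350) (fun t s' => t ≤ Nat.log 2 m + 1 ∧
    s'.nat 10 0 ≤ s'.nat 11 0 ∧ s'.nat 11 0 ≤ m ∧
    (s'.nat 10 0 = 0 ∨ ¬ Feasible k c C τ (s.real 2 (s'.nat 10 0 - 1))) ∧
    (s'.nat 11 0 = m ∨ Feasible k c C τ (s.real 2 (s'.nat 11 0))) ∧
    (s'.nat 11 0 - s'.nat 10 0) * 2 ^ t ≤ m) ?_ (fun _ _ h => h.1) ?_).mono ?_ ?_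
  · simp [hm3]
  · rintro t s' hs ⟨ht, hle, hhi, h1, h2, hsz⟩ hb
    have e2 : s'.real 2 = s.real 2 := by rw [hs.real 2 (by decide)]; simp
    have e0 : s'.real 0 = s.real 0 := by rw [hs.real 0 (by decide)]; simp
    have hlt : s'.nat 10 0 < s'.nat 11 0 := by
      simpa [Test.Holds, NExpr.eval] using hb
    have hR : Ready k c m big C s' := by
      refine h.congr ?_ ?_ ?_ e0 ?_
      · rw [hs.nat 0 (by decide)]; simp
      · rw [hs.nat 1 (by decide)]; simp
      · rw [hs.nat 2 (by decide)]; simp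
      · rw [hs.real 3 (by decide)]; simp
    have hlog : t < Nat.log 2 m + 1 := by
      refine Nat.lt_succ_of_le (Nat.le_log_of_pow_le (by norm_num) (le_trans ?_ hsz))
      exact Nat.le_mul_of_pos_left _ (by omega)
    obtain ⟨mid, hmid⟩ : ∃ mid, mid = (s'.nat 10 0 + s'.nat 11 0) / 2 := ⟨_, rfl⟩
    have e8 : s'.real 8 0 = (2 * k + 1) * τ := by rw [hs.real 8 (by decide)]; simpa using hτ
    refine (halts_bisectBody hA hR (by rwa [e0, e2]) (by rwa [e2]) e8 rfl rfl hmid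
      (by omega)).mono le_rfl ?_
    have hstep : ∀ d, d * 2 ≤ s'.nat 11 0 - s'.nat 10 0 → d * 2 ^ (t + 1) ≤ m := fun d hd =>
      le_trans (by rw [pow_succ']; nlinarith [Nat.mul_le_mul_right (2 ^ t) hd]) hsz
    rw [e2]
    rintro s'' - (⟨hf, h3, h4⟩ | ⟨hf, h3, h4⟩) <;> rw [h3, h4]
    · exact ⟨hlog, by omega, by omega, h1, .inr hf, hstep _ (by omega)⟩
    · exact ⟨hlog, by omega, by omega, .inr (by simpa using hf), h2, hstep _ (by omega)⟩
  · simp [Test.steps, NExpr.steps]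
  · rintro s' - ⟨t, ⟨-, hle, hhi, h1, h2, -⟩, hb⟩
    have hge : s'.nat 11 0 ≤ s'.nat 10 0 := by
      simpa [Test.Holds, NExpr.eval] using hb
    have e := le_antisymm hle hge
    rw [← e] at h2
    exact ⟨by omega, h1, h2⟩

/-- Account for edge `9` in the connection costs if its center is the new one. -/
def relaxBody : Prog :=
  .ite (.conj (.natLe (.read 1 (nvar 9)) (nvar 13))
      (.conj (.natLe (nvar 13) (.read 1 (nvar 9)))
        (.realLe (.read 0 (nvar 9)) (.read 3 (.read 2 (nvar 9))))))
    (.setReal 3 (.read 2 (nvar 9)) (.read 0 (nvar 9))) .skip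

/-- After `t` edges exactly the customers joined to `i` by one of them have their new distance.
Customers without such an edge need no update, since their cost to `i` is `∞`. -/
theorem halts_relax {m : ℕ} {big : ℝ} {C : Finset (Fin u)} {s : Mem} {i : Fin u}
    (h : Ready k c m big C s) (hi : s.nat 13 0 = i)
    (hbig : ∀ i j, c i j ≠ ⊤ → c i j ≤ ENNReal.ofReal big) :
    Halts (forTo 9 3 relaxBody) s ((m + 1) * 60) fun s' =>
      Ready k c m big (insert i C) s' := by
  classical
  refine (halts_forTo (B := 40) h.m_eq (by decide) (by decide) (by decide)
    (fun t s' => ∀ j : Fin n, s'.real 3 j =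
      if ∃ l < t, s.nat 1 l = i ∧ s.nat 2 l = j then min (dist c big C j) (trunc big (c i j))
      else dist c big C j) ?_ ?_ ?_).mono (by omega) ?_
  · intro t s' v h; simpa using h
  · simpa using h.dist_eq
  · intro t s' ht hs htt hI
    have e1 : s'.nat 1 = s.nat 1 := hs.nat 1 (by decide)
    have e2 : s'.nat 2 = s.nat 2 := hs.nat 2 (by decide)
    have e0 : s'.real 0 = s.real 0 := hs.real 0 (by decide)
    have e13 : s'.nat 13 0 = i := by rw [hs.nat 13 (by decide), hi]
    obtain ⟨i', j', hi', hj', hc, hw⟩ := h.edges.mem t ht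
    have hmin : ∀ j : Fin n, i' = i → j' = j →
        min (s'.real 3 j) (s.real 0 t) = min (dist c big C j) (trunc big (c i j)) := by
      rintro j rfl rfl
      rw [hI, hw, ← trunc_of_le (hbig _ _ hc)]
      split_ifs <;> simp
    have hex : ∀ j : Fin n, (∃ l < t + 1, s.nat 1 l = i ∧ s.nat 2 l = j) ↔
        (∃ l < t, s.nat 1 l = i ∧ s.nat 2 l = j) ∨ (i' = i ∧ j' = j) := by
      intro j
      simp only [Nat.lt_succ_iff_lt_or_eq, or_and_right, exists_or, exists_eq_left, hi', hj',
        Fin.val_inj]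
    refine (Halts.of_wp ?_).mono (by decide) fun _ _ => id
    simp only [relaxBody, Prog.wp, Test.Holds, NExpr.eval, RExpr.eval, htt, e1, e2, e0, e13, hi', hj',
      hex]
    refine ⟨fun ⟨h1, h2, h3⟩ j => ?_, fun hneg j => ?_⟩
    · have hii : i' = i := Fin.ext (le_antisymm h1 h2)
      simp only [Mem.storeReal_real, if_pos]
      by_cases hj : j' = j
      · rw [if_pos (.inr ⟨hii, hj⟩), ← hmin j hii hj, ← hj, Function.update_self, min_eq_right h3]
      · rw [Function.update_of_ne (fun e => hj (Fin.ext e.symm)), hI]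
        simp [hj]
    · by_cases hij : i' = i ∧ j' = j
      · rw [if_pos (.inr hij), ← hmin j hij.1 hij.2, min_eq_left]
        by_contra! hcon
        exact hneg ⟨hij.1 ▸ le_rfl, hij.1 ▸ le_rfl, hij.2 ▸ hcon.le⟩
      · simp only [hij, or_false]
        exact hI j
  · intro s' hs hI
    have e1 : s'.nat 1 = s.nat 1 := hs.nat 1 (by decide)
    have e2 : s'.nat 2 = s.nat 2 := hs.nat 2 (by decide)
    have e0 : s'.nat 0 = s.nat 0 := hs.nat 0 (by decide)
    have er : s'.real 0 = s.real 0 := hs.real 0 (by decide)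
    refine ⟨by rw [e1, e2, er]; exact h.edges, e0 ▸ h.k_eq, e0 ▸ h.n_eq, e0 ▸ h.m_eq, fun j => ?_⟩
    rw [hI, dist_insert]
    split_ifs with hex
    · rfl
    · have hc : c i j = ⊤ := by
        by_contra hc
        obtain ⟨l, hl, h1⟩ := h.edges.exists_eq i j hc
        exact hex ⟨l, hl, h1⟩
      have hle : dist c big C j ≤ trunc big ⊤ := trunc_mono big le_top
      rw [hc, min_eq_left hle]

/-- Compute the capped cost, scaled by `2 k + 1`, into the real scalar `12`. -/
def evaluate : Prog :=
  .seq (.ite (.realLe (rvar 10) (.read 2 (.sub (.read 0 (.const 3)) (.const 1))))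
      (.setReal 11 (.const 0) (rvar 10))
      (.setReal 11 (.const 0) (.read 2 (.sub (.read 0 (.const 3)) (.const 1)))))
    (.seq baseSums (.setReal 12 (.const 0) (.add (rvar 6) (.div (rvar 7) (rvar 10)))))

theorem halts_evaluate (hA : Admissible k c) {m : ℕ} {big : ℝ} {C : Finset (Fin u)} {s : Mem}
    (h : Ready k c m big C s) (hS : SortedValues m (s.real 0) (s.real 2))
    (hbig : s.real 2 (m - 1) < big) (hμ : 0 ≤ s.real 10 0) :
    Halts evaluate s ((n + 1) * 100) fun s' =>
      s'.real 12 0 = (2 * (k : ℝ) + 1) * cappedCost k c (bound k n (s.real 10 0)) C := by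
  refine Halts.mono (B := 30 + ((n + 1) * 50 + 10)) (Halts.seq_wp_le (by decide) ?_)
    (by omega) fun _ _ => id
  have hL0 : 0 ≤ min (s.real 10 0) (s.real 2 (m - 1)) :=
    le_min hμ (h.edges.breakpoint_nonneg hS (by have := (h.edges.breakpoint_zero hS hA).1; omega))
  have hrest : ∀ L, L = min (s.real 10 0) (s.real 2 (m - 1)) →
      Halts (.seq baseSums (.setReal 12 (.const 0) (.add (rvar 6) (.div (rvar 7) (rvar 10)))))
        (s.storeReal 11 0 L) ((n + 1) * 50 + 10) fun s' =>
        s'.real 12 0 = (2 * (k : ℝ) + 1) * cappedCost k c (bound k n (s.real 10 0)) C := by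
    intro L hL
    refine (halts_baseSums (h.congr (s' := s.storeReal 11 0 L) rfl rfl rfl rfl (by simp))).seq ?_
    rintro s' hs' ⟨h6, h7⟩
    have e10 : s'.real 10 0 = s.real 10 0 := by rw [hs'.real 10 (by decide)]; simp
    refine (Halts.of_wp ?_).mono (by decide) fun _ _ => id
    simp only [Mem.storeReal_real, if_pos, Function.update_self] at h6 h7
    rw [(h.edges.split_last hS (s.real 10 0)).cappedCost_eq hA hL0 (min_le_left _ _)
      ((min_le_right _ _).trans_lt hbig) C, ← hL]
    simp [Prog.wp, NExpr.eval, RExpr.eval, h6, h7, e10]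
  simp only [Prog.wp, Test.Holds, NExpr.eval, RExpr.eval, h.m_eq]
  exact ⟨fun hb => hrest _ (min_eq_left hb).symm,
    fun hb => hrest _ (min_eq_right (not_le.1 hb).le).symm⟩

end KMedian

namespace KMedian

/-! ## The main loop -/

variable {u n k : ℕ} {c : Fin u → Fin n → ℝ≥0∞}

/-- The number `k` as a real expression. -/
abbrev kExpr : RExpr := .ofNat (.read 0 (.const 0))

/-- The number `1 - 2 k / n` as a real expression. -/
abbrev slackExpr : RExpr :=
  .sub (.ofNat (.const 1)) (.div (.mul (.ofNat (.const 2)) kExpr) (.ofNat (.read 0 (.const 2))))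

/-- The number `2 k + 1` as a real expression. -/
abbrev capExpr : RExpr := .add (.mul (.ofNat (.const 2)) kExpr) (.ofNat (.const 1))

/-- Find the center to add and its breakpoint. -/
def findCenter : Prog :=
  .seq bisect (.seq (.setReal 11 (.const 0) (.read 2 (.sub (nvar 10) (.const 1)))) search)

/-- Add the center found to the list, and raise the bound. -/
def commit : Prog :=
  .seq (.ite (.natLe (.const 1) (nvar 12))
      (.ite (.realLe (rvar 10) (rvar 9)) (.setReal 10 (.const 0) (rvar 9)) .skip)
      (.setNat 3 (.const 0) (.const 1)))
    (.seq (.setNat 4 (.read 3 (.const 1)) (nvar 13))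
      (.setNat 3 (.const 1) (.add (.read 3 (.const 1)) (.const 1))))

/-- One iteration of `GREEDY'`. -/
def iteration : Prog :=
  .seq (.setReal 8 (.const 0) (.add
      (.mul (.sub (.ofNat (.const 1)) (.div (.ofNat (.const 1)) kExpr)) (rvar 12))
      (.mul (.div (.ofNat (.const 1)) kExpr) (.mul capExpr slackExpr))))
    (.seq findCenter (.seq commit (.seq (forTo 9 3 relaxBody) evaluate)))

/-- If bisection returns `x = 0`, truncated subtraction makes the threshold the breakpoint at index
`0`, which is `0` and hence an admissible lower end even when feasible. If `x = m`, no finite cost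
lies above the threshold. -/
theorem halts_findCenter (hA : Admissible k c) {m : ℕ} {big μ : ℝ} {C : Finset (Fin u)} {s : Mem}
    (h : Ready k c m big C s) (hS : SortedValues m (s.real 0) (s.real 2))
    (hbig : s.real 2 (m - 1) < big) (hg : 1 ≤ cappedCost k c (bound k n μ) C)
    (hτ : s.real 8 0 = (2 * k + 1) * target k c (bound k n μ) C) :
    Halts findCenter s ((m + 1) * (Nat.log 2 m + 2) * 600) fun s' =>
      ∃ i : Fin u, s'.nat 13 0 = i ∧
        (s'.nat 12 0 ≠ 0 → 0 ≤ s'.real 9 0 ∧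
          GreedyStep k c (bound k n μ) C (bound k n (max μ (s'.real 9 0))) (insert i C)) ∧
        (s'.nat 12 0 = 0 → GreedyStep k c (bound k n μ) C ⊤ (insert i C)) := by
  obtain ⟨hm, hS0⟩ := h.edges.breakpoint_zero hS hA
  refine Halts.mono (B := (m + 1) * (Nat.log 2 m + 2) * 370 + (10 + (m + 1) * 320))
    ((halts_bisect hA h hS hbig hτ).seq ?_) (by nlinarith [Nat.zero_le (m * Nat.log 2 m)])
    fun _ _ => id
  rintro s' hs' ⟨hm', hlow, hhigh⟩
  refine Halts.seq_wp_le (by decide) ?_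
  have e2 : s'.real 2 = s.real 2 := hs'.real 2 (by decide)
  have e8 : s'.real 8 0 = s.real 8 0 := by rw [hs'.real 8 (by decide)]
  have hR : Ready k c m big C s' := h.congr (hs'.nat 0 (by decide)) (hs'.nat 1 (by decide))
    (hs'.nat 2 (by decide)) (hs'.real 0 (by decide)) (hs'.real 3 (by decide))
  set x := s'.nat 10 0 with hx
  simp only [Prog.wp, NExpr.eval, RExpr.eval, ← hx, e2]
  refine (halts_search (hR.congr (s' := s'.storeReal 11 0 (s.real 2 (x - 1))) rfl rfl rfl rfl
    (by simp)) hm (h.edges.le_card hA)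
    fun i j hc => (h.edges.le_last hS hc).trans (ENNReal.ofReal_le_ofReal hbig.le)).mono le_rfl ?_
  intro s'' _ hb
  simp only [Mem.storeReal_real, if_pos, Function.update_self, if_neg (by norm_num : ¬ 8 = 11),
    e8, hτ] at hb
  have hx1 : x - 1 < m := by omega
  have hlow' : s.real 2 (x - 1) = 0 ∨
      ¬ Feasible k c C (target k c (bound k n μ) C) (s.real 2 (x - 1)) := by
    rcases hlow with h0 | h0
    · left; rw [h0]; exact hS0
    · exact .inr h0
  have hhigh' : (∃ R, s.real 2 (x - 1) ≤ R ∧ Feasible k c C (target k c (bound k n μ) C) R ∧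
      Split c (s.real 2 (x - 1)) R) ∨ ∀ R, Split c (s.real 2 (x - 1)) R := by
    by_cases hxm : x = m
    · right; rw [hxm]; exact h.edges.split_last' hS
    · left
      refine ⟨_, hS.mono _ _ (Nat.sub_le x 1) (by omega), hhigh.resolve_left hxm, ?_⟩
      by_cases hx0 : x = 0
      · rw [hx0]; exact .refl _
      · have hsucc : x - 1 + 1 = x := by omega
        have := h.edges.split_succ hS (x := x - 1) (by omega)
        rwa [hsucc] at this
  obtain ⟨i, hi, h1, h2⟩ := hb.greedyStep hA hg (h.edges.breakpoint_nonneg hS hx1)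
    ((hS.mono _ _ (by omega) (by omega)).trans_lt hbig) hlow' hhigh'
  exact ⟨i, hi.symm, h1, h2⟩

/-- The memory holds the state `(lam, C)` of an execution. -/
structure Holds (k : ℕ) (c : Fin u → Fin n → ℝ≥0∞) (m : ℕ) (big : ℝ) (lam : ℝ≥0∞)
    (C : Finset (Fin u)) (s : Mem) : Prop where
  ready : Ready k c m big C s
  centers : C.image Fin.val = (Finset.range (s.nat 3 1)).image (s.nat 4)
  value : (s.nat 3 0 ≠ 0 ∧ lam = ⊤) ∨ (s.nat 3 0 = 0 ∧ 0 ≤ s.real 10 0 ∧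
    lam = bound k n (s.real 10 0) ∧ s.real 12 0 = (2 * (k : ℝ) + 1) * cappedCost k c lam C)

/-- The list may repeat a center, so nothing has to be tested before appending; only its set of
entries represents `C`. -/
theorem halts_commit {lam lam' : ℝ} {s : Mem} {C : Finset (Fin u)} {i : Fin u}
    (hμ : s.real 10 0 = lam) (hv : s.real 9 0 = lam') (hflag : s.nat 3 0 = 0)
    (hi : s.nat 13 0 = i)
    (hC : C.image Fin.val = (Finset.range (s.nat 3 1)).image (s.nat 4)) :
    Halts commit s 60 fun s' =>
      (insert i C).image Fin.val = (Finset.range (s'.nat 3 1)).image (s'.nat 4) ∧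
      (s.nat 12 0 ≠ 0 → s'.nat 3 0 = 0 ∧ s'.real 10 0 = max lam lam') ∧
      (s.nat 12 0 = 0 → s'.nat 3 0 ≠ 0 ∧ s'.real 10 0 = lam) := by
  have himg : (insert i C).image Fin.val = (Finset.range (s.nat 3 1 + 1)).image
      (Function.update (s.nat 4) (s.nat 3 1) i) := by
    rw [Finset.image_insert, hC, Finset.range_add_one, Finset.image_insert, Function.update_self]
    congr 1
    refine Finset.image_congr fun l hl => ?_
    rw [Function.update_of_ne]
    exact (Finset.mem_range.1 hl).ne
  refine (Halts.of_wp ?_).mono (by decide) fun _ _ => id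
  simp only [commit, Prog.wp, Test.Holds, NExpr.eval, RExpr.eval, hμ, hv]
  refine ⟨fun h1 => ⟨fun h2 => ?_, fun h2 => ?_⟩, fun h1 => ?_⟩
  · simp [himg, hi, hflag, max_eq_right h2]
    omega
  · simp [himg, hi, hflag, hμ, max_eq_left (not_le.1 h2).le]
    omega
  · simp [himg, hi, hμ]
    omega

theorem halts_iteration (hA : Admissible k c) {m : ℕ} {big : ℝ} {lam : ℝ≥0∞}
    {C : Finset (Fin u)} {s : Mem} (h : Holds k c m big lam C s)
    (hS : SortedValues m (s.real 0) (s.real 2)) (hbig : s.real 2 (m - 1) < big)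
    (hflag : s.nat 3 0 = 0) (hg : 2 * (k : ℝ) + 1 ≤ s.real 12 0) :
    Halts iteration s ((m + 1) * (Nat.log 2 m + 2) * 1000) fun s' =>
      ∃ lam' C', GreedyStep k c lam C lam' C' ∧ Holds k c m big lam' C' s' := by
  obtain ⟨hR, hC, ⟨hne, -⟩ | ⟨-, hμ, rfl, h12⟩⟩ := h
  · exact absurd hflag hne
  have hK : (0 : ℝ) < 2 * k + 1 := by positivity
  have hguard : 1 ≤ cappedCost k c (bound k n (s.real 10 0)) C := by
    rw [h12] at hg
    by_contra! hcon
    nlinarith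
  have hnm := hR.edges.le_card hA
  refine Halts.mono (B := 60 + ((m + 1) * (Nat.log 2 m + 2) * 600 +
    (60 + ((m + 1) * 60 + (n + 1) * 100)))) (Halts.seq_wp_le (by decide) ?_) ?_ fun _ _ => id
  rotate_right
  · have : (n + 1) * 100 ≤ (m + 1) * 100 := by omega
    nlinarith [Nat.zero_le (m * Nat.log 2 m)]
  simp only [Prog.wp]
  set v := RExpr.eval s _ with hv
  -- The memory holds the capped cost multiplied by `2k + 1`, so the recurrence yields the target
  -- with the same factor.
  have hvτ : v = (2 * k + 1) * target k c (bound k n (s.real 10 0)) C := by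
    rw [hv]
    simp only [RExpr.eval, NExpr.eval, hR.k_eq, hR.n_eq, h12, target]
    push_cast
    ring
  refine (halts_findCenter hA
    (hR.congr (s' := s.storeReal 8 0 v) rfl rfl rfl rfl (by simp)) (by simpa using hS)
    (by simpa using hbig) hguard (by simpa using hvτ)).seq ?_
  rintro s₁ hs₁ ⟨i, hi, hf, hf'⟩
  have e3 : s₁.nat 3 = s.nat 3 := by rw [hs₁.nat 3 (by decide)]; simp
  have e4 : s₁.nat 4 = s.nat 4 := by rw [hs₁.nat 4 (by decide)]; simp
  have er0 : s₁.real 0 = s.real 0 := by rw [hs₁.real 0 (by decide)]; simp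
  have er2 : s₁.real 2 = s.real 2 := by rw [hs₁.real 2 (by decide)]; simp
  have e10 : s₁.real 10 = s.real 10 := by rw [hs₁.real 10 (by decide)]; simp
  have hR₁ : Ready k c m big C s₁ := by
    refine hR.congr ?_ ?_ ?_ er0 ?_
    · rw [hs₁.nat 0 (by decide)]; simp
    · rw [hs₁.nat 1 (by decide)]; simp
    · rw [hs₁.nat 2 (by decide)]; simp
    · rw [hs₁.real 3 (by decide)]; simp
  refine (halts_commit rfl rfl (by rw [e3, hflag]) hi (by rwa [e3, e4])).seq ?_
  rintro s₂ hs₂ ⟨hC₂, hfin, hinf⟩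
  have hR₂ : Ready k c m big C s₂ := hR₁.congr (hs₂.nat 0 (by decide)) (hs₂.nat 1 (by decide))
    (hs₂.nat 2 (by decide)) (hs₂.real 0 (by decide)) (hs₂.real 3 (by decide))
  refine (halts_relax hR₂ (i := i) (by rw [hs₂.nat 13 (by decide), hi]) fun i j hc =>
    (hR.edges.le_last hS hc).trans (ENNReal.ofReal_le_ofReal hbig.le)).seq ?_
  intro s₃ hs₃ hR₃
  have er0' : s₃.real 0 = s.real 0 := by
    rw [hs₃.real 0 (by decide), hs₂.real 0 (by decide), er0]
  have er2' : s₃.real 2 = s.real 2 := by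
    rw [hs₃.real 2 (by decide), hs₂.real 2 (by decide), er2]
  have e10' : s₃.real 10 = s₂.real 10 := hs₃.real 10 (by decide)
  have hμ₃ : 0 ≤ s₃.real 10 0 := by
    rw [e10']
    by_cases hz : s₁.nat 12 0 = 0
    · rw [(hinf hz).2, e10]; exact hμ
    · rw [(hfin hz).2, e10]
      exact hμ.trans (le_max_left _ _)
  refine (halts_evaluate hA hR₃ (by rwa [er0', er2']) (by rwa [er2']) hμ₃).mono le_rfl ?_
  intro s₄ hs₄ h₄
  have hR₄ : Ready k c m big (insert i C) s₄ := hR₃.congr (hs₄.nat 0 (by decide))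
    (hs₄.nat 1 (by decide)) (hs₄.nat 2 (by decide)) (hs₄.real 0 (by decide))
    (hs₄.real 3 (by decide))
  have e3' : s₄.nat 3 = s₂.nat 3 := by rw [hs₄.nat 3 (by decide), hs₃.nat 3 (by decide)]
  have e4' : s₄.nat 4 = s₂.nat 4 := by rw [hs₄.nat 4 (by decide), hs₃.nat 4 (by decide)]
  have e10'' : s₄.real 10 0 = s₃.real 10 0 := by rw [hs₄.real 10 (by decide)]
  have hC₄ : (insert i C).image Fin.val = (Finset.range (s₄.nat 3 1)).image (s₄.nat 4) := by
    rwa [e3', e4']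
  -- If no center reaches the target, the parameter is `∞`. The registers for `μ` and the capped
  -- cost are then irrelevant, because the flag alone ends the loop.
  by_cases hz : s₁.nat 12 0 = 0
  · exact ⟨_, _, hf' hz, hR₄, hC₄, .inl ⟨by rw [e3']; exact (hinf hz).1, rfl⟩⟩
  · have hmax : s₃.real 10 0 = max (s.real 10 0) (s₁.real 9 0) := by
      rw [e10', (hfin hz).2, e10]
    refine ⟨_, _, (hf hz).2, hR₄, hC₄, .inr ⟨by rw [e3']; exact (hfin hz).1, ?_, ?_, ?_⟩⟩
    · rw [e10'']; exact hμ₃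
    · rw [e10'', hmax]
    · rw [h₄, hmax]

/-! ### Initialization and the complete program -/

/-- Set the connection costs to the value that stands for infinity. -/
def initDist : Prog := forTo 9 2 (.setReal 3 (nvar 9) (rvar 13))

theorem halts_initDist {s : Mem} (hn : s.nat 0 2 = n) :
    Halts initDist s ((n + 1) * 30) fun s' => ∀ j : Fin n, s'.real 3 j = s.real 13 0 := by
  refine (halts_forTo (B := 10) hn (by decide) (by decide) (by decide)
    (fun t s' => ∀ j < t, s'.real 3 j = s.real 13 0) ?_ ?_ ?_).mono (by omega) ?_
  · intro t s' v h; simpa using h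
  · simp
  · intro t s' ht hs htt hI
    have e13 : s'.real 13 = s.real 13 := hs.real 13 (by decide)
    refine (Halts.of_wp ?_).mono (by decide) fun _ _ => id
    simp only [Prog.wp, NExpr.eval, RExpr.eval, htt, e13, Mem.storeReal_real, if_pos]
    intro j hj
    by_cases hjt : j = t
    · simp [hjt]
    · rw [Function.update_of_ne hjt]
      exact hI j (by omega)
  · exact fun s' _ hI j => hI j j.2

/-- The initialization after sorting. -/
def init : Prog :=
  .seq (.setReal 13 (.const 0)
      (.add (.read 2 (.sub (.read 0 (.const 3)) (.const 1))) (.ofNat (.const 1))))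
    (.seq initDist (.setReal 12 (.const 0) (.ofNat (.read 0 (.const 2)))))

/-- The loop of `GREEDY'`. -/
def mainLoop : Prog :=
  .while (.conj (.natLe (nvar 3) (.const 0)) (.realLe capExpr (rvar 12))) iteration

/-- The implementation of `GREEDY'`. -/
def greedyProg : Prog :=
  .seq sort (.seq init (.seq mainLoop
    (.setReal 1 (.const 0) (.mul (.mul slackExpr capExpr) (rvar 10)))))

/-- The invariant includes a run of length `t`, so the combinatorial bound `GreedyRun.le_T` is
itself the bound on the number of loop rounds. -/
theorem halts_mainLoop (hA : Admissible k c) {m : ℕ} {big : ℝ} {s : Mem}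
    (h : Holds k c m big 0 ∅ s) (hS : SortedValues m (s.real 0) (s.real 2))
    (hbig : s.real 2 (m - 1) < big) :
    Halts mainLoop s ((T k n + 1) * ((m + 1) * (Nat.log 2 m + 2) * 1100)) fun s' =>
      ∃ lam C, GreedyReturns k c lam C ∧ Holds k c m big lam C s' := by
  have hK : (0 : ℝ) < 2 * k + 1 := by positivity
  refine (Halts.loop (N := T k n) (B := (m + 1) * (Nat.log 2 m + 2) * 1000) (fun t s' =>
    ∃ lam C, GreedyRun k c t lam C ∧ Holds k c m big lam C s') ⟨0, ∅, .start, h⟩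
    (fun t s' ⟨lam, C, hr, _⟩ => hr.le_T hA) ?_).mono ?_ ?_
  · rintro t s' hs ⟨lam, C, hr, hH⟩ hb
    have e0 : s'.real 0 = s.real 0 := hs.real 0 (by decide)
    have e2 : s'.real 2 = s.real 2 := hs.real 2 (by decide)
    simp only [Test.Holds, NExpr.eval, RExpr.eval, hH.ready.k_eq] at hb
    refine (halts_iteration hA hH (by rwa [e0, e2]) (by rwa [e2]) (by omega)
      (by simpa using hb.2)).mono le_rfl ?_
    rintro s'' - ⟨lam', C', hstep, hH'⟩
    exact ⟨lam', C', hr.next hstep, hH'⟩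
  · refine Nat.mul_le_mul_left _ ?_
    simp only [Test.steps, NExpr.steps, RExpr.steps]
    nlinarith [Nat.zero_le (m * Nat.log 2 m)]
  · rintro s' - ⟨t, ⟨lam, C, hr, hH⟩, hb⟩
    refine ⟨lam, C, ⟨t, hr, ?_⟩, hH⟩
    simp only [Test.Holds, NExpr.eval, RExpr.eval, hH.ready.k_eq] at hb
    rcases hH.value with ⟨-, rfl⟩ | ⟨h0, -, -, h12⟩
    · rw [cappedCost_top]; norm_num
    · have : ¬ (2 * (k : ℝ) + 1 ≤ s'.real 12 0) := fun hle => hb ⟨h0.le, by simpa using hle⟩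
      rw [h12] at this
      by_contra! hcon
      exact this (by nlinarith)

theorem mem_edges {p : Fin u × Fin n} : p ∈ edges c ↔ c p.1 p.2 ≠ ⊤ := by simp [edges]

theorem edgeList_input (e : Fin (numEdges c) ≃ edges c) :
    EdgeList c (numEdges c) ((input k c e).nat 1) ((input k c e).nat 2) ((input k c e).real 0) := by
  have h1 : ∀ l (h : l < numEdges c), (input k c e).nat 1 l = (e ⟨l, h⟩).1.1 := fun l h => by
    simp [input, h]
  have h2 : ∀ l (h : l < numEdges c), (input k c e).nat 2 l = (e ⟨l, h⟩).1.2 := fun l h => by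
    simp [input, h]
  refine ⟨fun l hl => ⟨(e ⟨l, hl⟩).1.1, (e ⟨l, hl⟩).1.2, h1 l hl, h2 l hl,
    mem_edges.1 (e ⟨l, hl⟩).2, ?_⟩, ?_, ?_⟩
  · simp [input, hl]
  · intro i j hc
    have hmem : (i, j) ∈ edges c := mem_edges.2 hc
    refine ⟨e.symm ⟨(i, j), hmem⟩, (e.symm ⟨(i, j), hmem⟩).2, ?_, ?_⟩
    · rw [h1 _ (e.symm ⟨(i, j), hmem⟩).2]; simp
    · rw [h2 _ (e.symm ⟨(i, j), hmem⟩).2]; simp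
  · intro l hl l' hl' e1 e2
    rw [h1 l hl, h1 l' hl'] at e1
    rw [h2 l hl, h2 l' hl'] at e2
    have := e.injective (Subtype.ext (Prod.ext (Fin.ext e1) (Fin.ext e2)))
    simpa using this

theorem halts_greedyProg (hA : Admissible k c) {m : ℕ} {s : Mem}
    (hE : EdgeList c m (s.nat 1) (s.nat 2) (s.real 0)) (hk : s.nat 0 0 = k) (hn : s.nat 0 2 = n)
    (hm : s.nat 0 3 = m) (h3 : s.nat 3 = fun _ => 0) (h6 : s.nat 6 = fun _ => 0)
    (h10 : s.real 10 0 = 0) :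
    Halts greedyProg s ((T k n + 2) * ((m + 1) * (Nat.log 2 m + 2) * 1200)) fun s' =>
      ∃ lam C, GreedyReturns k c lam C ∧ Output s' lam C := by
  have hnm := hE.le_card hA
  refine Halts.mono (B := (m + 1) * (Nat.log 2 m + 2) * 300 + ((20 + ((n + 1) * 30 + 10)) +
    ((T k n + 1) * ((m + 1) * (Nat.log 2 m + 2) * 1100) + 60)))
    ((halts_sort hm h6).seq ?_) ?_ fun _ _ => id
  rotate_right
  · set X := (m + 1) * (Nat.log 2 m + 2) with hX
    have h1 : m + 1 ≤ X := Nat.le_mul_of_pos_right _ (by omega)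
    have : (n + 1) * 30 ≤ (m + 1) * 30 := by omega
    nlinarith [Nat.zero_le (T k n * X)]
  intro s₁ hs₁ hS
  have e1 : ∀ a, a ∉ sort.natWrites → s₁.nat a = s.nat a := hs₁.nat
  have hS₁ : SortedValues m (s₁.real 0) (s₁.real 2) := by
    rwa [hs₁.real 0 (by decide)]
  have hinit : Halts init s₁ (20 + ((n + 1) * 30 + 10)) fun s' =>
      s₁.real 2 (m - 1) < s'.real 13 0 ∧ (∀ j : Fin n, s'.real 3 j = s'.real 13 0) ∧
        s'.real 12 0 = n := by
    refine Halts.seq_wp_le (by decide) ?_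
    simp only [Prog.wp, NExpr.eval, RExpr.eval]
    have e0 : s₁.nat 0 = s.nat 0 := e1 0 (by decide)
    refine (halts_initDist (n := n) (by simp [e0, hn])).seq ?_
    intro s₂ hs₂ hd
    have e0' : s₂.nat 0 = s.nat 0 := by rw [hs₂.nat 0 (by decide)]; exact e0
    have e13 : s₂.real 13 0 = s₁.real 2 (m - 1) + 1 := by
      rw [hs₂.real 13 (by decide)]; simp [e0, hm]
    refine (Halts.of_wp ?_).mono (by decide) fun _ _ => id
    simp only [Prog.wp, NExpr.eval, RExpr.eval, e0']
    refine ⟨by simp [e13], fun j => ?_, by simp [hn]⟩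
    simp [hd j, e13, e0, hm]
  refine hinit.seq ?_
  rintro s₂ hs₂ ⟨hbig, hd, h12⟩
  have en : ∀ a, a ∉ sort.natWrites → a ∉ init.natWrites → s₂.nat a = s.nat a :=
    fun a h h' => (hs₂.nat a h').trans (hs₁.nat a h)
  have er : ∀ a, a ∉ sort.realWrites → a ∉ init.realWrites → s₂.real a = s.real a :=
    fun a h h' => (hs₂.real a h').trans (hs₁.real a h)
  have er2 : s₂.real 2 = s₁.real 2 := hs₂.real 2 (by decide)
  have er0 : s₂.real 0 = s₁.real 0 := hs₂.real 0 (by decide)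
  have hm0 : 0 < m := (hE.breakpoint_zero hS hA).1
  have hbig0 : 0 ≤ s₂.real 13 0 :=
    (hE.breakpoint_nonneg hS (by omega : m - 1 < m)).trans hbig.le
  have e10 : s₂.real 10 0 = 0 := by rw [er 10 (by decide) (by decide), h10]
  have e3 : s₂.nat 3 = fun _ => 0 := by rw [en 3 (by decide) (by decide), h3]
  have e0 : s₂.nat 0 = s.nat 0 := en 0 (by decide) (by decide)
  have hH : Holds k c m (s₂.real 13 0) 0 ∅ s₂ := by
    refine ⟨⟨?_, ?_, ?_, ?_, ?_⟩, ?_, .inr ⟨?_, e10.ge, ?_, ?_⟩⟩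
    · rw [en 1 (by decide) (by decide), en 2 (by decide) (by decide), er 0 (by decide) (by decide)]
      exact hE
    · rw [e0, hk]
    · rw [e0, hn]
    · rw [e0, hm]
    · intro j; rw [hd, dist_empty hbig0]
    · simp [e3]
    · rw [e3]
    · simp [e10, bound]
    -- All `n` customers start at the cap `1 / (2k + 1)`, so the scaled capped cost is `n`.
    · rw [h12, cappedCost_zero_empty hA]; field_simp
  refine (halts_mainLoop hA hH (by rwa [er0, er2]) (by rwa [er2])).seq ?_
  rintro s₃ - ⟨lam, C, hret, hH₃⟩
  refine (Halts.of_wp ?_).mono (by decide) fun _ _ => id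
  refine ⟨lam, C, hret, ?_, hH₃.centers⟩
  rcases hH₃.value with ⟨h1, h2⟩ | ⟨h1, h2, h3, -⟩
  · exact .inl ⟨h1, h2⟩
  · refine .inr ⟨h1, ?_, ?_⟩
    · simp [NExpr.eval, RExpr.eval, hH₃.ready.k_eq, hH₃.ready.n_eq]
      exact mul_nonneg hA.scale_pos.le h2
    · simp [NExpr.eval, RExpr.eval, hH₃.ready.k_eq, hH₃.ready.n_eq, h3, bound]

end KMedian

namespace KMedian

/-! ## The time bound -/

variable {u n k : ℕ} {c : Fin u → Fin n → ℝ≥0∞}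

theorem one_le_log_of_three_le {x : ℝ} (h : 3 ≤ x) : 1 ≤ Real.log x := by
  rw [Real.le_log_iff_exp_le (by linarith)]
  linarith [Real.exp_one_lt_d9]

theorem natLog_add_two_le {m : ℕ} (hm : 3 ≤ m) : (Nat.log 2 m : ℝ) + 2 ≤ 4 * Real.log m := by
  have h1 : 1 ≤ Real.log m := one_le_log_of_three_le (by exact_mod_cast hm)
  have h2 : (Nat.log 2 m : ℝ) * Real.log 2 ≤ Real.log m := by
    rw [← Real.log_pow]
    refine Real.log_le_log (by positivity) ?_
    exact_mod_cast Nat.pow_log_le_self 2 (by omega)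
  have h3 := Real.log_two_gt_d9
  have h4 : (0 : ℝ) ≤ Nat.log 2 m := Nat.cast_nonneg _
  nlinarith

/-- Dropping constants in the denominator gives `T < 2 k ln (n/k) + 1`. The remaining constant 3 is
absorbed because `n/k ≥ 3` makes `k ln (n/k) ≥ 1`. -/
theorem Admissible.T_add_two_le (h : Admissible k c) :
    (T k n : ℝ) + 2 ≤ 5 * (k * Real.log ((n : ℝ) / k)) := by
  have hk := h.k_pos
  have hk2 : (2 : ℝ) ≤ k := by exact_mod_cast h.two_le
  have h3 : (3 : ℝ) * k ≤ n := by exact_mod_cast h.three_mul_le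
  have hl : 1 ≤ Real.log ((n : ℝ) / k) :=
    one_le_log_of_three_le (by rw [le_div_iff₀ hk]; exact h3)
  have hle : Real.log ((n : ℝ) ^ 2 / (2 * k * (2 * k + 1))) ≤ 2 * Real.log ((n : ℝ) / k) := by
    rw [← Nat.cast_two (R := ℝ), ← Real.log_pow, Nat.cast_two, div_pow]
    have hn := h.n_pos
    refine Real.log_le_log (by positivity) ?_
    refine div_le_div_of_nonneg_left (by positivity) (by positivity) (by nlinarith)
  have h0 : 0 ≤ Real.log ((n : ℝ) ^ 2 / (2 * k * (2 * k + 1))) := by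
    refine Real.log_nonneg ?_
    rw [le_div_iff₀ (by positivity)]
    nlinarith
  have hT := Nat.ceil_lt_add_one (mul_nonneg hk.le h0)
  rw [T]
  nlinarith

theorem Admissible.time_le (h : Admissible k c) {m t : ℕ} (hm : n ≤ m)
    (ht : t ≤ (T k n + 2) * ((m + 1) * (Nat.log 2 m + 2) * 1200)) :
    (t : ℝ) ≤ 48000 * (k * m * Real.log ((n : ℝ) / k) * Real.log m) := by
  have hk2 := h.two_le
  have hn := h.three_mul_le
  have h1 := natLog_add_two_le (by omega : 3 ≤ m)
  have h2 := h.T_add_two_le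
  have h3 : (m : ℝ) + 1 ≤ 2 * m := by
    have : (1 : ℝ) ≤ m := by exact_mod_cast (by omega : 1 ≤ m)
    linarith
  have h4 : 0 ≤ 5 * (k * Real.log ((n : ℝ) / k)) :=
    le_trans (by positivity) h2
  calc (t : ℝ) ≤ ((T k n : ℝ) + 2) * (((m : ℝ) + 1) * ((Nat.log 2 m : ℝ) + 2) * 1200) := by
        exact_mod_cast ht
    -- The absolute constant is `5 * 2 * 4 * 1200 = 48000`; the bound `m + 1 ≤ 2 m` and the one for
    -- `Nat.log 2 m` use `m ≥ n ≥ 6`.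
    _ ≤ (5 * (k * Real.log ((n : ℝ) / k))) * ((2 * m) * (4 * Real.log m) * 1200) := by gcongr
    _ = _ := by ring

end KMedian

theorem mainTheorem2 :
    -- Every execution of the greedy algorithm keeps the invariants, makes at most `T` iterations,
    -- and can continue as long as the capped cost is at least one.
    (∀ (u n k : ℕ) (c : Fin u → Fin n → ENNReal), KMedian.Admissible k c →
      ∀ (t : ℕ) (lam : ENNReal) (C : Finset (Fin u)), KMedian.GreedyRun k c t lam C →
        lam ≤ KMedian.lpOpt k c ∧
        KMedian.cappedCost k c lam C ≤
          (1 - 1 / (k : ℝ)) ^ t * ((n : ℝ) / (2 * k + 1)) +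
            (1 - (1 - 1 / (k : ℝ)) ^ t) * (1 - 2 * (k : ℝ) / n) ∧
        t ≤ KMedian.T k n ∧
        C.card ≤ t ∧
        (1 ≤ KMedian.cappedCost k c lam C → ∃ lam' C', KMedian.GreedyStep k c lam C lam' C')) ∧
    -- One program implements it within the time bound, from the instance alone.
    (∃ (P : KMedian.Prog) (A : ℝ),
      ∀ (u n k : ℕ) (c : Fin u → Fin n → ENNReal), KMedian.Admissible k c →
        ∀ e : Fin (KMedian.numEdges c) ≃ KMedian.edges c,
          ∃ (t : ℕ) (s : KMedian.Mem) (lam : ENNReal) (C : Finset (Fin u)),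
            KMedian.Exec P (KMedian.input k c e) t s ∧
            (t : ℝ) ≤ A * (k * KMedian.numEdges c * Real.log ((n : ℝ) / k) *
              Real.log (KMedian.numEdges c)) ∧
            KMedian.Output s lam C ∧
            KMedian.GreedyReturns k c lam C ∧
            lam ≤ KMedian.lpOpt k c ∧
            C.card ≤ KMedian.T k n ∧
            KMedian.cappedCost k c lam C < 1) := by
  refine ⟨fun u n k c h t lam C hr => ⟨hr.le_lpOpt h, hr.cappedCost_le h, hr.le_T h, hr.card_le,
    h.exists_greedyStep⟩, KMedian.greedyProg, 48000, fun u n k c h e => ?_⟩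
  have hE := KMedian.edgeList_input (k := k) e
  obtain ⟨t, s, hexec, ht, lam, C, hret, hout⟩ :=
    KMedian.halts_greedyProg h hE rfl rfl rfl rfl rfl rfl
  obtain ⟨t', hr, hlt⟩ := hret
  exact ⟨t, s, lam, C, hexec, h.time_le (hE.le_card h) ht, hout, ⟨t', hr, hlt⟩, hr.le_lpOpt h,
    hr.card_le.trans (hr.le_T h), hlt⟩
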